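/- Let $q$ be a prime and let $\kappa:\{0,1,2,\dots\}\to\mathbb{N}$ be a non-decreasing function with $\kappa(0)=2$. Let $\mathbf{F}=\ast_{i\in\mathbb{Z}}\langle a_i\rangle$ be the free product of copies $\langle a_i\rangle\cong\mathbb{Z}/q\mathbb{Z}$ indexed by $\mathbb{Z}$. For a finite set $Y\subset\mathbb{Z}$ and $k\ge 2$, let $[Y]_k$ be the set of iterated commutators $[\dots[[a_{i_1},a_{i_2}],a_{i_3}],\dots,a_{i_k}]$ with $i_1,\dots,i_k\in Y$. Let $N$ be the quotient of $\mathbf{F}$ by the normal subgroup generated by the sets $[Y]_{\kappa(\mathrm{Diam}\,Y)}$, over all finite non-empty $Y\subset\mathbb{Z}$, where $\mathrm{Diam}(Y)=\max\{|i-j|: i,j\in Y\}$. Let $G=G(q,\kappa)=N\rtimes\mathbb{Z}$, where $\mathbb{Z}$ acts by translating the indices of the $a_i$. For a unitary representation $\pi$ of a group $\Gamma$ on a complex Hilbert space $\mathcal{H}$, let $Z^1(\Gamma,\pi)$ be the space of maps $b:\Gamma\to\mathcal{H}$ with $b(gh)=b(g)+\pi_g b(h)$ for all $g,h$, let $B^1(\Gamma,\pi)$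 be the subspace of maps $g\mapsto v-\pi_g v$ with $v\in\mathcal{H}$, and let $\overline{H}^1(\Gamma,\pi)=Z^1(\Gamma,\pi)/\overline{B^1(\Gamma,\pi)}$, with the closure for uniform convergence on finite subsets of $\Gamma$. The group $\Gamma$ has property $H_{\mathrm{T}}$ (resp. $H_{\mathrm{FD}}$) if every unitary representation $\pi$ with $\overline{H}^1(\Gamma,\pi)\ne 0$ has a non-zero subrepresentation that is trivial (resp. finite-dimensional). Let $\mathbb{T}_q$ be the $(q+1)$-regular tree, with a fixed end $\omega$, and let $\mathrm{DA}_{\mathbb{Z}/q\mathbb{Z}}(\mathbb{T}_q)$ be its discrete affine group. Explicitly, a vertex of $\mathbb{T}_q$ is a pair $(n,w)$ with $n\in\mathbb{Z}$ and $w:\mathbb{Z}\to\mathbb{Z}/q\mathbb{Z}$ finitely supported with $w(i)=0$ for $i<n$, and it is joined to the vertex $(n+1,w')$, where $w'$ is $w$ with the value at $n$ replaced by $0$. The group $\mathrm{DA}_{\mathbb{Z}/q\mathbb{Z}}(\mathbb{T}_q)$ is the group of automorphisms of $\mathbb{T}_q$ generated by the shift $(n,w)\mapsto(n+1,w(\cdot-1))$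 and by the automorphisms, one for each $c\in\mathbb{Z}/q\mathbb{Z}$, that add $c$ to $w(-1)$ if $n<0$ and $w(i)=0$ for all $i\ge 0$, and that fix all other vertices. Then: (i) If $\kappa$ is bounded, then $G$ has property $H_{\mathrm{T}}$. (ii) If $\kappa(n)>q^{n+1}$ for all $n\ge 1$, then $\mathrm{DA}_{\mathbb{Z}/q\mathbb{Z}}(\mathbb{T}_q)$ is a quotient of $G$, and $G$ does not have property $H_{\mathrm{FD}}$. -/

import Mathlib

/-! ### Reduced first cohomology and Shalom's properties -/

section Cohomology

universe u v

variable {G : Type u} [Group G] {H : Type v} [NormedAddCommGroup H] [InnerProductSpace ℂ H]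

/-- The space `Z¹(G, π)` of 1-cocycles of a unitary representation `π`:
maps `b` with `b (g h) = b g + π_g (b h)`. -/
def oneCocycles (π : G →* (H ≃ₗᵢ[ℂ] H)) : Submodule ℂ (G → H) where
  carrier := {b | ∀ g h : G, b (g * h) = b g + π g (b h)}
  add_mem' := by
    intro b c hb hc g h
    simp only [Set.mem_ofPred_eq] at hb hc
    simp only [Pi.add_apply, hb g h, hc g h, map_add]
    abel
  zero_mem' := by
    intro g h
    simp
  smul_mem' := by
    intro r b hb g h
    simp only [Set.mem_ofPred_eq] at hb
    simp only [Pi.smul_apply, hb g h, map_smul, smul_add]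

/-- The space `B¹(G, π)` of 1-coboundaries: maps of the form `b g = v - π_g v`. -/
def oneCoboundaries (π : G →* (H ≃ₗᵢ[ℂ] H)) : Submodule ℂ (G → H) where
  carrier := {b | ∃ v : H, ∀ g : G, b g = v - π g v}
  add_mem' := by
    rintro b c ⟨v, hv⟩ ⟨w, hw⟩
    refine ⟨v + w, fun g => ?_⟩
    simp only [Pi.add_apply, hv g, hw g, map_add]
    abel
  zero_mem' := ⟨0, fun g => by simp⟩
  smul_mem' := by
    rintro r b ⟨v, hv⟩
    refine ⟨r • v, fun g => ?_⟩
    simp only [Pi.smul_apply, hv g, map_smul, smul_sub]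

/-- The reduced first cohomology `Z¹(G, π) / closure B¹(G, π)`. The closure is taken in `G → H`
with the product topology, that is, for uniform convergence on finite subsets of `G`. -/
abbrev ReducedH1 (π : G →* (H ≃ₗᵢ[ℂ] H)) : Type _ :=
  ↥(oneCocycles π) ⧸
    Submodule.comap (oneCocycles π).subtype (oneCoboundaries π).topologicalClosure

end Cohomology

/-- Property `H_T`: every unitary representation on a complex Hilbert space with non-zero reduced
first cohomology has a non-zero subrepresentation on which the group acts trivially. -/
def HasPropertyHT.{u, v} (G : Type u) [Group G] : Prop :=
  ∀ (H : Type v) [NormedAddCommGroup H] [InnerProductSpace ℂ H] [CompleteSpace H]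
    (π : G →* (H ≃ₗᵢ[ℂ] H)), Nontrivial (ReducedH1 π) →
      ∃ W : Submodule ℂ H, W ≠ ⊥ ∧ ∀ g : G, ∀ w ∈ W, π g w = w

/-- Property `H_FD`: every unitary representation on a complex Hilbert space with non-zero reduced
first cohomology has a non-zero finite-dimensional subrepresentation. -/
def HasPropertyHFD.{u, v} (G : Type u) [Group G] : Prop :=
  ∀ (H : Type v) [NormedAddCommGroup H] [InnerProductSpace ℂ H] [CompleteSpace H]
    (π : G →* (H ≃ₗᵢ[ℂ] H)), Nontrivial (ReducedH1 π) →
      ∃ W : Submodule ℂ H, W ≠ ⊥ ∧ FiniteDimensional ℂ W ∧ ∀ g : G, ∀ w ∈ W, π g w ∈ W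

/-! ### Gromov's groups -/

namespace Gromov

/-- The free product of copies of `ℤ/q` indexed by `ℤ`. -/
abbrev FreeProd (q : ℕ) : Type := Monoid.CoprodI (fun _ : ℤ => Multiplicative (ZMod q))

/-- The generator `a_i` of the `i`-th free factor. -/
def gen (q : ℕ) (i : ℤ) : FreeProd q :=
  Monoid.CoprodI.of (M := fun _ : ℤ => Multiplicative (ZMod q)) (i := i)
    (Multiplicative.ofAdd (1 : ZMod q))

/-- The left-normed iterated commutator `[[[g₁, g₂], g₃], …, g_k]` of a list,
where `[x, y] = x y x⁻¹ y⁻¹`. -/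
def leftCommutator {G : Type*} [Group G] : List G → G
  | [] => 1
  | g :: l => l.foldl (fun x y => x * y * x⁻¹ * y⁻¹) g

/-- The set `[Y]_k` of left-normed commutators of `k` letters `a_i` with `i ∈ Y`. -/
def commutators (q : ℕ) (Y : Finset ℤ) (k : ℕ) : Set (FreeProd q) :=
  {x | ∃ l : List ℤ, l.length = k ∧ (∀ i ∈ l, i ∈ Y) ∧ x = leftCommutator (l.map (gen q))}

/-- The union of the sets `[Y]_{k(Y)}` over all finite `Y ⊆ ℤ`. -/
def relators (q : ℕ) (k : Finset ℤ → ℕ) : Set (FreeProd q) :=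
  {x | ∃ Y : Finset ℤ, x ∈ commutators q Y (k Y)}

/-- The group `N(k)`: the quotient of the free product by the relations `[Y]_{k(Y)}`. -/
abbrev N (q : ℕ) (k : Finset ℤ → ℕ) : Type :=
  FreeProd q ⧸ Subgroup.normalClosure (relators q k)

/-- Translation of the indices by `z` on the free product. -/
def shiftFree (q : ℕ) (z : ℤ) : FreeProd q →* FreeProd q :=
  Monoid.CoprodI.lift (fun i : ℤ =>
    Monoid.CoprodI.of (M := fun _ : ℤ => Multiplicative (ZMod q)) (i := i + z))

theorem shiftFree_gen (q : ℕ) (z i : ℤ) : shiftFree q z (gen q i) = gen q (i + z) := by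
  simp [shiftFree, gen]

theorem shiftFree_of (q : ℕ) (z i : ℤ) (x : Multiplicative (ZMod q)) :
    shiftFree q z (Monoid.CoprodI.of (M := fun _ : ℤ => Multiplicative (ZMod q)) (i := i) x) =
      Monoid.CoprodI.of (M := fun _ : ℤ => Multiplicative (ZMod q)) (i := i + z) x := by
  simp [shiftFree]

theorem shiftFree_zero (q : ℕ) : shiftFree q 0 = MonoidHom.id _ := by
  refine Monoid.CoprodI.ext_hom _ _ (fun i => MonoidHom.ext fun x => ?_)
  simp only [MonoidHom.comp_apply, shiftFree_of, MonoidHom.id_apply, add_zero]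

theorem shiftFree_comp (q : ℕ) (y z : ℤ) :
    (shiftFree q y).comp (shiftFree q z) = shiftFree q (y + z) := by
  refine Monoid.CoprodI.ext_hom _ _ (fun i => MonoidHom.ext fun x => ?_)
  simp only [MonoidHom.comp_apply, shiftFree_of, add_assoc, add_comm z y]

theorem map_leftCommutator {G K : Type*} [Group G] [Group K] (f : G →* K) (l : List G) :
    f (leftCommutator l) = leftCommutator (l.map f) := by
  cases l with
  | nil => simp [leftCommutator]
  | cons g l =>
    simp only [leftCommutator, List.map_cons]
    induction l generalizing g with
    | nil => rfl
    | cons h l ih =>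
      simp only [List.foldl_cons, List.map_cons]
      rw [ih]
      simp only [map_mul, map_inv]

/-- Invariance of `k` under translation of finite subsets of `ℤ`. -/
def Invariant (k : Finset ℤ → ℕ) : Prop :=
  ∀ (Y : Finset ℤ) (z : ℤ), k (Y.image (fun i => i + z)) = k Y

theorem shiftFree_mem {q : ℕ} {k : Finset ℤ → ℕ} (hk : Invariant k) (z : ℤ) :
    Subgroup.normalClosure (relators q k) ≤
      (Subgroup.normalClosure (relators q k)).comap (shiftFree q z) := by
  apply Subgroup.normalClosure_le_normal
  rintro x ⟨Y, l, hl, hY, rfl⟩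
  apply Subgroup.subset_normalClosure
  refine ⟨Y.image (fun i => i + z), l.map (fun i => i + z), ?_, ?_, ?_⟩
  · rw [hk Y z, List.length_map, hl]
  · intro j hj
    obtain ⟨i, hi, rfl⟩ := List.mem_map.1 hj
    exact Finset.mem_image_of_mem _ (hY i hi)
  · rw [map_leftCommutator, List.map_map, List.map_map]
    exact congrArg leftCommutator (List.map_congr_left fun i _ => shiftFree_gen q z i)

/-- Translation of the indices by `z` on `N(k)`. -/
def shiftN (q : ℕ) (k : Finset ℤ → ℕ) (hk : Invariant k) (z : ℤ) : N q k →* N q k :=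
  QuotientGroup.map _ _ (shiftFree q z) (shiftFree_mem hk z)

theorem shiftN_zero (q : ℕ) (k : Finset ℤ → ℕ) (hk : Invariant k) (x : N q k) :
    shiftN q k hk 0 x = x := by
  induction x using QuotientGroup.induction_on with
  | H x => simp [shiftN, shiftFree_zero]

theorem shiftN_shiftN (q : ℕ) (k : Finset ℤ → ℕ) (hk : Invariant k) (y z : ℤ) (x : N q k) :
    shiftN q k hk y (shiftN q k hk z x) = shiftN q k hk (y + z) x := by
  induction x using QuotientGroup.induction_on with
  | H x => simp [shiftN, ← shiftFree_comp]

/-- The action of `ℤ` on `N(k)` by translation of the indices. -/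
def shiftAction (q : ℕ) (k : Finset ℤ → ℕ) (hk : Invariant k) :
    Multiplicative ℤ →* MulAut (N q k) where
  toFun z :=
    { toFun := shiftN q k hk z.toAdd
      invFun := shiftN q k hk (-z.toAdd)
      left_inv := fun x => by rw [shiftN_shiftN, neg_add_cancel, shiftN_zero]
      right_inv := fun x => by rw [shiftN_shiftN, add_neg_cancel, shiftN_zero]
      map_mul' := map_mul _ }
  map_one' := MulEquiv.ext fun x => shiftN_zero q k hk x
  map_mul' y z := MulEquiv.ext fun x => (shiftN_shiftN q k hk y.toAdd z.toAdd x).symm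

/-- `Diam(Y) = max {|i - j| : i, j ∈ Y}` (and `0` for the empty set). -/
def diam (Y : Finset ℤ) : ℕ := (Y ×ˢ Y).sup (fun p => (p.1 - p.2).natAbs)

/-- The function `k(Y) = κ(Diam(Y))`. -/
def kOf (κ : ℕ → ℕ) (Y : Finset ℤ) : ℕ := κ (diam Y)

theorem kOf_invariant (κ : ℕ → ℕ) : Invariant (kOf κ) := by
  intro Y z
  unfold kOf diam
  congr 1
  rw [← Finset.prodMap_image_product, Finset.sup_image]
  congr 1
  funext p
  simp

/-- Gromov's group `G(q, κ) = N(κ ∘ Diam) ⋊ ℤ`. -/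
abbrev GromovGroup (q : ℕ) (κ : ℕ → ℕ) : Type :=
  N q (kOf κ) ⋊[shiftAction q (kOf κ) (kOf_invariant κ)] Multiplicative ℤ

end Gromov

/-! ### The regular tree and the discrete affine group -/

namespace DiscreteAffine

/-- The vertices of the `(q+1)`-regular tree, in horocyclic coordinates relative to an end `ω`:
a vertex is a level `n ∈ ℤ` together with a finitely supported labelling of the integers `i ≥ n`
by `ℤ/q` (extended by `0` to `i < n`). -/
structure Vertex (q : ℕ) where
  level : ℤ
  label : ℤ →₀ ZMod q
  label_eq_zero : ∀ i < level, label i = 0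

theorem Vertex.ext' {q : ℕ} {u v : Vertex q} (h : u.level = v.level)
    (h' : ∀ i, u.label i = v.label i) : u = v := by
  cases u
  cases v
  have := Finsupp.ext h'
  simp_all

/-- The neighbour of a vertex in the direction of `ω`: forget the label of index `n`. The other
neighbours are the `q` vertices at level `n - 1` that have the given vertex as parent. -/
noncomputable def parent {q : ℕ} (v : Vertex q) : Vertex q where
  level := v.level + 1
  label := v.label.erase v.level
  label_eq_zero := by
    intro i hi
    rcases eq_or_ne i v.level with h | h
    · rw [h, Finsupp.erase_same]
    · rw [Finsupp.erase_ne h]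
      exact v.label_eq_zero i (by omega)

/-- The `(q+1)`-regular tree. -/
def tree (q : ℕ) : SimpleGraph (Vertex q) where
  Adj u v := parent u = v ∨ parent v = u
  symm := ⟨fun _ _ h => h.symm⟩
  loopless := ⟨fun v h => by
    have h' : parent v = v := h.elim id id
    have : v.level + 1 = v.level := congrArg Vertex.level h'
    omega⟩

/-- A bijection of the vertices that commutes with `parent` is an automorphism of the tree. -/
def autOfParent {q : ℕ} (e : Equiv.Perm (Vertex q)) (he : ∀ v, parent (e v) = e (parent v)) :
    tree q ≃g tree q where
  toEquiv := e
  map_rel_iff' := by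
    intro u v
    simp only [tree, he, e.apply_eq_iff_eq]

/-- Translate the level and the indices of the labels by `z`. -/
def translate {q : ℕ} (z : ℤ) (v : Vertex q) : Vertex q where
  level := v.level + z
  label := v.label.equivMapDomain (Equiv.addRight z)
  label_eq_zero := by
    intro i hi
    simp only [Finsupp.equivMapDomain_apply]
    exact v.label_eq_zero _ (by simp; omega)

theorem translate_label {q : ℕ} (z : ℤ) (v : Vertex q) (i : ℤ) :
    (translate z v).label i = v.label (i - z) := by
  simp [translate, Finsupp.equivMapDomain_apply, sub_eq_add_neg]

/-- The shift by one step towards `ω` along the bi-infinite ray of the vertices whose labels all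
vanish. -/
noncomputable def shift (q : ℕ) : tree q ≃g tree q :=
  autOfParent
    { toFun := translate 1
      invFun := translate (-1)
      left_inv := fun v => Vertex.ext' (by simp [translate]) (fun i => by simp [translate_label])
      right_inv := fun v => Vertex.ext' (by simp [translate]) (fun i => by simp [translate_label]) }
    (fun v => Vertex.ext' rfl (fun i => by
      simp only [Equiv.coe_fn_mk]
      rw [translate_label]
      simp only [parent, Finsupp.erase_apply, translate_label]
      have : i - 1 = v.level ↔ i = v.level + 1 := sub_eq_iff_eq_add
      by_cases h : i = (translate 1 v).level
      · rw [if_pos h, if_pos (this.2 h)]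
      · rw [if_neg h, if_neg (fun h' => h (this.1 h'))]))

/-- The vertex `v` lies strictly below the vertex `o` of level `0` with zero labels, that is, in
one of the `q` components, not containing `ω`, of the complement of `o`. These components
are distinguished by the label of index `-1`. -/
def Below {q : ℕ} (v : Vertex q) : Prop := v.level < 0 ∧ ∀ i : ℤ, 0 ≤ i → v.label i = 0

open Classical in
/-- Translate by `c ∈ ℤ/q` the `q` components below `o`, and fix all other vertices. -/
noncomputable def rotateFun {q : ℕ} (c : ZMod q) (v : Vertex q) : Vertex q where
  level := v.level
  label := if Below v then v.label + Finsupp.single (-1) c else v.label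
  label_eq_zero := by
    intro i hi
    split_ifs with h
    · have h2 : v.level < 0 := h.1
      have h3 : i ≠ -1 := by omega
      simp [v.label_eq_zero i hi, h3]
    · exact v.label_eq_zero i hi

open Classical in
theorem rotateFun_label {q : ℕ} (c : ZMod q) (v : Vertex q) (i : ℤ) :
    (rotateFun c v).label i = v.label i + if Below v ∧ i = -1 then c else 0 := by
  by_cases h : Below v <;> by_cases hi : i = -1 <;> simp [rotateFun, h, hi]

theorem below_rotateFun {q : ℕ} (c : ZMod q) (v : Vertex q) : Below (rotateFun c v) ↔ Below v := by
  refine and_congr_right fun _ => forall₂_congr fun i hi => ?_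
  have : i ≠ -1 := by omega
  rw [rotateFun_label]
  simp [this]

theorem rotateFun_rotateFun {q : ℕ} (c d : ZMod q) (v : Vertex q) (h : c + d = 0) :
    rotateFun c (rotateFun d v) = v := by
  refine Vertex.ext' rfl (fun i => ?_)
  rw [rotateFun_label, rotateFun_label]
  have hb := below_rotateFun d v
  split_ifs
  · rw [add_assoc, add_comm d c, h, add_zero]
  · exfalso; tauto
  · exfalso; tauto
  · simp

theorem parent_rotateFun {q : ℕ} (c : ZMod q) (v : Vertex q) :
    parent (rotateFun c v) = rotateFun c (parent v) := by
  refine Vertex.ext' rfl (fun i => ?_)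
  rw [rotateFun_label]
  change ((rotateFun c v).label.erase v.level) i = (v.label.erase v.level) i + _
  rw [Finsupp.erase_apply, Finsupp.erase_apply, rotateFun_label]
  by_cases hi : i = v.level
  · have : ¬ (Below (parent v) ∧ i = -1) := by
      rintro ⟨⟨h1, -⟩, h2⟩
      have h1' : v.level + 1 < 0 := h1
      omega
    rw [if_neg this, if_pos hi, if_pos hi, add_zero]
  · have : (Below v ∧ i = -1) ↔ (Below (parent v) ∧ i = -1) := by
      refine and_congr_left fun h1 => ?_
      constructor
      · rintro ⟨h2, h3⟩
        refine ⟨(by omega : v.level + 1 < 0), fun j hj => ?_⟩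
        change (v.label.erase v.level) j = 0
        rw [Finsupp.erase_ne (by omega)]
        exact h3 j hj
      · rintro ⟨h2, h3⟩
        have h2' : v.level + 1 < 0 := h2
        refine ⟨by omega, fun j hj => ?_⟩
        have h4 : (v.label.erase v.level) j = 0 := h3 j hj
        rwa [Finsupp.erase_ne (by omega)] at h4
    rw [if_neg hi, if_neg hi]
    split_ifs <;> first | rfl | (exfalso; tauto)

/-- The copy of `ℤ/q` in the automorphism group of the tree that permutes, by translations, the
`q` subtrees hanging at the vertex `o`. -/
noncomputable def rotate (q : ℕ) (c : ZMod q) : tree q ≃g tree q :=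
  autOfParent
    { toFun := rotateFun c
      invFun := rotateFun (-c)
      left_inv := fun v => rotateFun_rotateFun _ _ v (neg_add_cancel c)
      right_inv := fun v => rotateFun_rotateFun _ _ v (add_neg_cancel c) }
    (parent_rotateFun c)

/-- The discrete affine group `DA_{ℤ/q}(𝕋_q)`: the group of automorphisms of the tree generated by
the shift and the copy of `ℤ/q` permuting the subtrees below `o`. -/
noncomputable def DA (q : ℕ) : Subgroup (tree q ≃g tree q) :=
  Subgroup.closure ({shift q} ∪ Set.range (rotate q))

end DiscreteAffine

universe v

/-!
A bounded `κ` makes the group `N` nilpotent: a left-normed commutator of maximal length contains a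
relator as an initial segment. As `N` is generated by elements of order `q`, the factors of its
lower central series have exponent `q`. Property `H_T` is then proved along this series. A
representation without invariant vectors splits, at each term `A` of the series, into the
`A`-invariant vectors and their complement. On the complement the next term may be assumed to act
trivially, so one is reduced to a torsion group `A` that is central in `N` and has no invariant
vectors (`vanishes_of_central_torsion`). Every finite subgroup `F` of `A` has a centre `v_F`, the
fixed point closest to the origin of the affine action defined by the cocycle `b`. As `F` exhausts
`A`, the coboundary of `v_F` converges to `b` on `N`. At the translation `t` there remains the
error `v_{tFt⁻¹} - v_F`. For the groups `F` generated by the translates of index `-n, …, n` of a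
finite set these errors are differences of orthogonal increments, of norm `O(√n)`
(`norm_proj_center_le`), so that averages with weights `1 / n` make them as small as one likes.

If `κ(n) > q ^ (n + 1)`, the `a_i` can be mapped to the rotations of the tree at the translates of
`o`. The rotations with indices in an interval of length `n + 1` generate an iterated wreath product
of copies of `ℤ/q`, in which commutators of length `q ^ (n + 1)` vanish. This is seen in the
permutation representation over `ℤ/q`, where the corresponding products of difference operators
vanish (`list_prod_insert_eq_zero`, `prod_diffOp_eq_zero`).

Property `H_FD` fails for the representation of `G` on the square summable functions on the
vertices of the tree. It has no finite-dimensional subrepresentation since the shift moves all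
levels. Let `f` be the indicator function of the vertices with last label `0`. The cocycle
`g ↦ f - g f` takes finitely supported values, and it is not a limit of coboundaries because its
pairing with an explicit `1`-cycle with square summable coefficients is not zero
(`notMem_closure_of_cycle`). The cycle comes from the function `balanced`, whose value decays like
`q ^ (-n)` on the `q ^ n` vertices at distance `n` below `o`.
-/

namespace UnitaryRep

/-! ### Cocycles, subrepresentations and quotient groups -/

section Basic

variable {G : Type*} [Group G] {H : Type*} [NormedAddCommGroup H] [InnerProductSpace ℂ H]
  {π : G →* (H ≃ₗᵢ[ℂ] H)} {b : G → H}

/-- The coboundary `g ↦ v - π_g v` of a vector `v`. -/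
def coboundary (π : G →* (H ≃ₗᵢ[ℂ] H)) (v : H) : G → H := fun g => v - π g v

theorem coboundary_mem (v : H) : coboundary π v ∈ oneCoboundaries π := ⟨v, fun _ => rfl⟩

theorem map_mul_apply (g h : G) (x : H) : π (g * h) x = π g (π h x) := by
  rw [map_mul]; rfl

theorem map_one_apply (x : H) : π 1 x = x := by
  rw [map_one]; rfl

theorem map_inv_map_apply (g : G) (x : H) : π g⁻¹ (π g x) = x := by
  rw [← map_mul_apply, inv_mul_cancel, map_one_apply]

theorem map_map_inv_apply (g : G) (x : H) : π g (π g⁻¹ x) = x := by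
  rw [← map_mul_apply, mul_inv_cancel, map_one_apply]

theorem coboundary_mem_oneCocycles (v : H) : coboundary π v ∈ oneCocycles π := by
  intro g h
  simp only [coboundary, map_mul_apply, map_sub]
  abel

theorem sub_coboundary_weighted {N : ℕ} {c : ℕ → ℂ} (hc : ∑ n ∈ Finset.range N, c n ≠ 0)
    (v : ℕ → H) (g : G) :
    b g - coboundary π ((∑ n ∈ Finset.range N, c n)⁻¹ • ∑ n ∈ Finset.range N, c n • v n) g =
      (∑ n ∈ Finset.range N, c n)⁻¹ •
        ∑ n ∈ Finset.range N, c n • (b g - coboundary π (v n) g) := by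
  rw [eq_inv_smul_iff₀ hc, coboundary, smul_sub, smul_sub, map_smul, smul_inv_smul₀ hc,
    smul_inv_smul₀ hc, map_sum, Finset.sum_smul, ← Finset.sum_sub_distrib, ← Finset.sum_sub_distrib]
  refine Finset.sum_congr rfl fun n _ => ?_
  rw [coboundary, smul_sub, smul_sub, map_smul]

theorem cocycle_mul (hb : b ∈ oneCocycles π) (g h : G) : b (g * h) = b g + π g (b h) := hb g h

theorem cocycle_one (hb : b ∈ oneCocycles π) : b 1 = 0 := by
  have := cocycle_mul hb 1 1
  rw [mul_one, map_one_apply] at this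
  simpa using this

theorem cocycle_inv (hb : b ∈ oneCocycles π) (g : G) : b g⁻¹ = -π g⁻¹ (b g) := by
  have := cocycle_mul hb g⁻¹ g
  rw [inv_mul_cancel, cocycle_one hb] at this
  exact eq_neg_of_add_eq_zero_left this.symm

theorem cocycle_pow (hb : b ∈ oneCocycles π) (g : G) (n : ℕ) :
    b (g ^ n) = ∑ i ∈ Finset.range n, π (g ^ i) (b g) := by
  induction n with
  | zero => simp [cocycle_one hb]
  | succ n ih => rw [pow_succ, cocycle_mul hb, ih, Finset.sum_range_succ]

/-- A cocycle is zero on the elements of finite order that act trivially, since it restricts to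
a homomorphism on the kernel of `π`. -/
theorem cocycle_eq_zero_of_isOfFinOrder (hb : b ∈ oneCocycles π) {g : G} (hg : IsOfFinOrder g)
    (h : π g = 1) : b g = 0 := by
  obtain ⟨n, hn, hgn⟩ := isOfFinOrder_iff_pow_eq_one.1 hg
  have h1 := cocycle_pow hb g n
  rw [hgn, cocycle_one hb] at h1
  have h2 : ∀ i ∈ Finset.range n, π (g ^ i) (b g) = b g := fun i _ => by
    rw [map_pow, h, one_pow]; rfl
  rw [Finset.sum_congr rfl h2, Finset.sum_const, Finset.card_range, ← Nat.cast_smul_eq_nsmul ℂ]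
    at h1
  exact (smul_eq_zero.1 h1.symm).resolve_left (by exact_mod_cast hn.ne')

variable (π) in
/-- The reduced first cohomology of `π` vanishes: `Z¹ ⊆ closure B¹`. -/
def ReducedH1Vanishes : Prop := oneCocycles π ≤ (oneCoboundaries π).topologicalClosure

theorem not_nontrivial_of_vanishes (h : ReducedH1Vanishes π) : ¬ Nontrivial (ReducedH1 π) := by
  rw [Submodule.Quotient.nontrivial_iff, not_not]
  exact Submodule.comap_subtype_eq_top.2 h

theorem nontrivial_of_notMem_closure (hb : b ∈ oneCocycles π)
    (h : b ∉ (oneCoboundaries π).topologicalClosure) : Nontrivial (ReducedH1 π) := by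
  rw [Submodule.Quotient.nontrivial_iff]
  exact fun h' => h (Submodule.comap_subtype_eq_top.1 h' hb)

/-- A cocycle that is approximated by coboundaries uniformly on a generating set lies in the
closure of the coboundaries: the size of a cocycle at `g` is controlled by its size on the
generators, with a constant that does not depend on the cocycle. -/
theorem mem_closure_of_approx {S : Set G} (hS : Subgroup.closure S = ⊤) (hb : b ∈ oneCocycles π)
    (h : ∀ ε > 0, ∃ v : H, ∀ s ∈ S, ‖b s - coboundary π v s‖ ≤ ε) :
    b ∈ (oneCoboundaries π).topologicalClosure := by
  have key : ∀ g : G, ∃ L : ℝ, ∀ c ∈ oneCocycles π, ∀ ε : ℝ, (∀ s ∈ S, ‖c s‖ ≤ ε) →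
      ‖c g‖ ≤ L * ε := by
    intro g
    have hg : g ∈ Subgroup.closure S := hS ▸ Subgroup.mem_top g
    induction hg using Subgroup.closure_induction with
    | mem x hx => exact ⟨1, fun c _ ε hε => by simpa using hε x hx⟩
    | one => exact ⟨0, fun c hc ε _ => by simp [cocycle_one hc]⟩
    | mul x y _ _ hx hy =>
      obtain ⟨L, hL⟩ := hx
      obtain ⟨L', hL'⟩ := hy
      refine ⟨L + L', fun c hc ε hε => ?_⟩
      rw [cocycle_mul hc, add_mul]
      refine (norm_add_le _ _).trans (add_le_add (hL c hc ε hε) ?_)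
      rw [LinearIsometryEquiv.norm_map]
      exact hL' c hc ε hε
    | inv x _ hx =>
      obtain ⟨L, hL⟩ := hx
      refine ⟨L, fun c hc ε hε => ?_⟩
      rw [cocycle_inv hc, norm_neg, LinearIsometryEquiv.norm_map]
      exact hL c hc ε hε
  choose v hv using fun n : ℕ => h (1 / ((n : ℝ) + 1)) (by positivity)
  refine mem_closure_of_tendsto (f := fun n => coboundary π (v n)) (b := Filter.atTop) ?_
    (Filter.Eventually.of_forall fun n => coboundary_mem (v n))
  rw [tendsto_pi_nhds]
  intro g
  obtain ⟨L, hL⟩ := key g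
  rw [tendsto_iff_norm_sub_tendsto_zero]
  have h0 : Filter.Tendsto (fun n : ℕ => L * (1 / ((n : ℝ) + 1))) Filter.atTop (nhds 0) := by
    simpa using tendsto_one_div_add_atTop_nhds_zero_nat.const_mul L
  refine squeeze_zero (fun _ => norm_nonneg _) (fun n => ?_) h0
  rw [norm_sub_rev]
  exact hL (b - coboundary π (v n)) (Submodule.sub_mem _ hb (coboundary_mem_oneCocycles _)) _
    (hv n)

end Basic

section Restrict

variable {G : Type*} [Group G] {H : Type*} [NormedAddCommGroup H] [InnerProductSpace ℂ H]

/-- The subrepresentation of `π` on an invariant subspace `W`. -/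
def restrict (π : G →* (H ≃ₗᵢ[ℂ] H)) (W : Submodule ℂ H) (hW : ∀ g, ∀ w ∈ W, π g w ∈ W) :
    G →* (W ≃ₗᵢ[ℂ] W) where
  toFun g :=
    { toFun := fun w => ⟨π g w, hW g w w.2⟩
      invFun := fun w => ⟨π g⁻¹ w, hW g⁻¹ w w.2⟩
      left_inv := fun w => Subtype.ext (map_inv_map_apply g _)
      right_inv := fun w => Subtype.ext (map_map_inv_apply g _)
      map_add' := fun x y => Subtype.ext (by simp)
      map_smul' := fun c x => Subtype.ext (by simp)
      norm_map' := fun x => (π g).norm_map x }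
  map_one' := by
    ext x
    exact map_one_apply (π := π) (x : H)
  map_mul' g h := by
    ext x
    exact map_mul_apply (π := π) g h (x : H)

variable {π : G →* (H ≃ₗᵢ[ℂ] H)} {W : Submodule ℂ H}

theorem orthogonal_invariant (hW : ∀ g, ∀ w ∈ W, π g w ∈ W) (g : G) : ∀ w ∈ Wᗮ, π g w ∈ Wᗮ := by
  intro w hw
  rw [Submodule.mem_orthogonal] at hw ⊢
  intro u hu
  rw [← map_map_inv_apply (π := π) g u, LinearIsometryEquiv.inner_map_map]
  exact hw _ (hW _ _ hu)

theorem starProjection_map_of_invariant [W.HasOrthogonalProjection]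
    (hW : ∀ g, ∀ w ∈ W, π g w ∈ W) (g : G) (x : H) :
    W.starProjection (π g x) = π g (W.starProjection x) := by
  refine Submodule.eq_starProjection_of_mem_orthogonal (hW g _ (W.starProjection_apply_mem x)) ?_
  rw [← map_sub]
  exact orthogonal_invariant hW g _ (W.sub_starProjection_mem_orthogonal x)

theorem mem_closure_of_vanishes_restrict (hW : ∀ g, ∀ w ∈ W, π g w ∈ W)
    (h : ReducedH1Vanishes (restrict π W hW)) {b : G → H} (hb : b ∈ oneCocycles π)
    (hbW : ∀ g, b g ∈ W) : b ∈ (oneCoboundaries π).topologicalClosure := by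
  have hc : (fun g => (⟨b g, hbW g⟩ : W)) ∈ oneCocycles (restrict π W hW) := fun g g' =>
    Subtype.ext (cocycle_mul hb g g')
  refine map_mem_closure (f := fun (c : G → W) (g : G) => (c g : H)) (by fun_prop) (h hc) ?_
  rintro c ⟨v, hv⟩
  exact ⟨v, fun g => congrArg Subtype.val (hv g)⟩

theorem vanishes_of_restrict [W.HasOrthogonalProjection] (hW : ∀ g, ∀ w ∈ W, π g w ∈ W)
    (h : ReducedH1Vanishes (restrict π W hW))
    (h' : ReducedH1Vanishes (restrict π Wᗮ (orthogonal_invariant hW))) :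
    ReducedH1Vanishes π := by
  intro b hb
  have h1 : (fun g => W.starProjection (b g)) ∈ oneCocycles π := fun g g' => by
    beta_reduce
    rw [cocycle_mul hb, map_add, starProjection_map_of_invariant hW]
  have h2 := Submodule.add_mem _
    (mem_closure_of_vanishes_restrict hW h h1 fun g => W.starProjection_apply_mem _)
    (mem_closure_of_vanishes_restrict (orthogonal_invariant hW) h' (Submodule.sub_mem _ hb h1)
      fun g => W.sub_starProjection_mem_orthogonal _)
  rwa [add_sub_cancel] at h2

end Restrict

section Quotient

variable {G : Type*} [Group G] {H : Type*} [NormedAddCommGroup H] [InnerProductSpace ℂ H]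
  {π : G →* (H ≃ₗᵢ[ℂ] H)}

/-- Vanishing of reduced cohomology passes from a quotient by a torsion normal subgroup that acts
trivially. -/
theorem vanishes_of_quotient {M : Subgroup G} [M.Normal] (hM : M ≤ π.ker)
    (htor : ∀ m ∈ M, IsOfFinOrder m) (h : ReducedH1Vanishes (QuotientGroup.lift M π hM)) :
    ReducedH1Vanishes π := by
  intro b hb
  have hbM : ∀ g g' : G, QuotientGroup.leftRel M g g' → b g = b g' := by
    intro g g' hg
    rw [QuotientGroup.leftRel_apply] at hg
    have h1 := cocycle_eq_zero_of_isOfFinOrder hb (htor _ hg) (hM hg)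
    have h2 := cocycle_mul hb g (g⁻¹ * g')
    rw [h1, map_zero, add_zero, mul_inv_cancel_left] at h2
    exact h2.symm
  let c : G ⧸ M → H := Quotient.lift b hbM
  have hc : c ∈ oneCocycles (QuotientGroup.lift M π hM) := by
    intro x y
    induction x using QuotientGroup.induction_on
    induction y using QuotientGroup.induction_on
    exact cocycle_mul hb _ _
  refine map_mem_closure (f := fun (c : G ⧸ M → H) (g : G) => c g) (by fun_prop) (h hc) ?_
  rintro c ⟨v, hv⟩
  exact ⟨v, fun g => hv g⟩

end Quotient

end UnitaryRep

namespace UnitaryRep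

/-! ### Projections onto invariant vectors and centres of finite subgroups -/

section Invariants

variable {G : Type*} [Group G] {H : Type*} [NormedAddCommGroup H] [InnerProductSpace ℂ H]

/-- The subgroup of the elements that fix a vector. -/
def stabilizer (π : G →* (H ≃ₗᵢ[ℂ] H)) (x : H) : Subgroup G where
  carrier := {g | π g x = x}
  one_mem' := map_one_apply x
  mul_mem' := by
    intro g h hg hh
    rw [Set.mem_ofPred_eq] at hg hh ⊢
    rw [map_mul_apply, hh, hg]
  inv_mem' := by
    intro g hg
    rw [Set.mem_ofPred_eq] at hg ⊢
    nth_rewrite 1 [← hg]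
    exact map_inv_map_apply g x

/-- The subspace of the vectors fixed by a subgroup. -/
def invariants (π : G →* (H ≃ₗᵢ[ℂ] H)) (F : Subgroup G) : Submodule ℂ H where
  carrier := {x | F ≤ stabilizer π x}
  zero_mem' := fun g _ => map_zero (π g)
  add_mem' := by
    intro x y hx hy g hg
    have h1 : π g x = x := hx hg
    have h2 : π g y = y := hy hg
    exact (map_add (π g) x y).trans (by rw [h1, h2])
  smul_mem' := by
    intro c x hx g hg
    have h1 : π g x = x := hx hg
    exact (map_smul (π g) c x).trans (by rw [h1])

variable {π : G →* (H ≃ₗᵢ[ℂ] H)} {E F : Subgroup G} {x : H}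

theorem mem_invariants : x ∈ invariants π F ↔ ∀ f ∈ F, π f x = x := Iff.rfl

theorem mem_invariants_iff_le : x ∈ invariants π F ↔ F ≤ stabilizer π x := Iff.rfl

theorem isClosed_invariants (π : G →* (H ≃ₗᵢ[ℂ] H)) (F : Subgroup G) :
    IsClosed (invariants π F : Set H) := by
  have : (invariants π F : Set H) = ⋂ f ∈ F, {x | π f x = x} := by
    ext x
    simp only [SetLike.mem_coe, mem_invariants, Set.mem_iInter, Set.mem_ofPred_eq]
  rw [this]
  exact isClosed_biInter fun f _ => isClosed_eq (π f).continuous continuous_id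

instance [CompleteSpace H] (π : G →* (H ≃ₗᵢ[ℂ] H)) (F : Subgroup G) :
    CompleteSpace (invariants π F) := (isClosed_invariants π F).completeSpace_coe

theorem invariants_anti (h : E ≤ F) : invariants π F ≤ invariants π E :=
  fun _ hx => h.trans hx

/-- The conjugate subgroup `g F g⁻¹`. -/
def conj (g : G) (F : Subgroup G) : Subgroup G := F.map (MulAut.conj g).toMonoidHom

theorem mem_conj {g x : G} : x ∈ conj g F ↔ ∃ f ∈ F, g * f * g⁻¹ = x := by
  simp [conj, Subgroup.mem_map]

theorem conj_mem_conj (g : G) {f : G} (hf : f ∈ F) : g * f * g⁻¹ ∈ conj g F :=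
  mem_conj.2 ⟨f, hf, rfl⟩

theorem map_mem_invariants_conj (g : G) (hx : x ∈ invariants π F) :
    π g x ∈ invariants π (conj g F) := by
  intro f' hf'
  obtain ⟨f, hf, rfl⟩ := mem_conj.1 hf'
  change π (g * f * g⁻¹) (π g x) = π g x
  rw [← map_mul_apply, inv_mul_cancel_right, map_mul_apply, mem_invariants.1 hx f hf]

theorem map_mem_orthogonal_conj (g : G) (hx : x ∈ (invariants π F)ᗮ) :
    π g x ∈ (invariants π (conj g F))ᗮ := by
  rw [Submodule.mem_orthogonal] at hx ⊢
  intro u hu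
  rw [← map_map_inv_apply (π := π) g u, LinearIsometryEquiv.inner_map_map]
  refine hx _ fun f hf => ?_
  have h1 := mem_invariants.1 hu _ (conj_mem_conj g hf)
  change π f (π g⁻¹ u) = π g⁻¹ u
  nth_rewrite 2 [← h1]
  rw [← map_mul_apply, ← map_mul_apply]
  congr 2
  group

variable [CompleteSpace H]

/-- The orthogonal projection onto the vectors fixed by a subgroup. -/
noncomputable def proj (π : G →* (H ≃ₗᵢ[ℂ] H)) (F : Subgroup G) : H →L[ℂ] H :=
  (invariants π F).starProjection

theorem proj_mem (x : H) : proj π F x ∈ invariants π F := Submodule.starProjection_apply_mem _ x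

theorem sub_proj_mem (x : H) : x - proj π F x ∈ (invariants π F)ᗮ :=
  Submodule.sub_starProjection_mem_orthogonal x

theorem proj_eq_self (hx : x ∈ invariants π F) : proj π F x = x :=
  Submodule.starProjection_eq_self_iff.2 hx

theorem proj_eq_zero (hx : x ∈ (invariants π F)ᗮ) : proj π F x = 0 :=
  (Submodule.starProjection_apply_eq_zero_iff _).2 hx

theorem norm_proj_le (x : H) : ‖proj π F x‖ ≤ ‖x‖ := Submodule.norm_starProjection_apply_le _ x

theorem proj_proj_of_le (h : E ≤ F) (x : H) : proj π F (proj π E x) = proj π F x :=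
  DFunLike.congr_fun (Submodule.starProjection_comp_starProjection_of_le (invariants_anti h)) x

theorem norm_proj_le_of_le (h : E ≤ F) (x : H) : ‖proj π F x‖ ≤ ‖proj π E x‖ := by
  rw [← proj_proj_of_le h]
  exact norm_proj_le _

theorem norm_sub_proj_sq (x : H) : ‖x - proj π F x‖ ^ 2 = ‖x‖ ^ 2 - ‖proj π F x‖ ^ 2 := by
  have h := Submodule.norm_sq_eq_add_norm_sq_starProjection x (invariants π F)
  rw [Submodule.starProjection_orthogonal_val] at h
  change _ = ‖proj π F x‖ ^ 2 + ‖x - proj π F x‖ ^ 2 at h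
  linarith

theorem proj_conj_map (g : G) (x : H) : proj π (conj g F) (π g x) = π g (proj π F x) := by
  refine Submodule.eq_starProjection_of_mem_orthogonal (map_mem_invariants_conj g (proj_mem x)) ?_
  rw [← map_sub]
  exact map_mem_orthogonal_conj g (sub_proj_mem x)

theorem conj_eq_of_commute {g : G} (h : ∀ f ∈ F, g * f = f * g) : conj g F = F := by
  ext x
  rw [mem_conj]
  constructor
  · rintro ⟨f, hf, rfl⟩
    rwa [h f hf, mul_inv_cancel_right]
  · intro hx
    exact ⟨x, hx, by rw [h x hx, mul_inv_cancel_right]⟩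

theorem proj_sup (h : ∀ e ∈ E, ∀ f ∈ F, e * f = f * e) (x : H) :
    proj π (E ⊔ F) x = proj π F (proj π E x) := by
  have h1 : proj π F (proj π E x) ∈ invariants π (E ⊔ F) := by
    rw [mem_invariants_iff_le]
    refine sup_le (fun e he => ?_) (proj_mem _)
    have h2 := proj_conj_map (π := π) (F := F) e (proj π E x)
    rw [conj_eq_of_commute (h e he), mem_invariants.1 (proj_mem x) e he] at h2
    exact h2.symm
  rw [← proj_eq_self h1, proj_proj_of_le le_sup_right, proj_proj_of_le le_sup_left]

/-- If no non-zero vector is fixed by `A`, then every vector is almost orthogonal to the vectors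
fixed by a suitable finitely generated subgroup of `A`. -/
theorem exists_finset_norm_proj_lt {A : Subgroup G} (hA : invariants π A = ⊥) (x : H) {ε : ℝ}
    (hε : 0 < ε) :
    ∃ T : Finset G, (T : Set G) ⊆ A ∧ ‖proj π (Subgroup.closure (T : Set G)) x‖ < ε := by
  classical
  let U : {T : Finset G // (T : Set G) ⊆ A} → Submodule ℂ H := fun T =>
    (invariants π (Subgroup.closure (T.1 : Set G)))ᗮ
  have hne : Nonempty {T : Finset G // (T : Set G) ⊆ A} := ⟨⟨∅, by simp⟩⟩
  have hdir : Directed (· ≤ ·) U := by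
    intro T T'
    refine ⟨⟨T.1 ∪ T'.1, by simpa using ⟨T.2, T'.2⟩⟩, ?_, ?_⟩ <;>
    · refine Submodule.orthogonal_le (invariants_anti (Subgroup.closure_mono ?_))
      simp
  have htop : (⨆ T, U T).topologicalClosure = ⊤ := by
    rw [Submodule.topologicalClosure_eq_top_iff, ← Submodule.iInf_orthogonal, eq_bot_iff, ← hA]
    intro y hy a ha
    have h1 := (Submodule.mem_iInf _).1 hy ⟨{a}, by simpa using ha⟩
    simp only [U, Submodule.orthogonal_orthogonal] at h1
    exact h1 (Subgroup.subset_closure (by simp))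
  have hx : x ∈ closure ((⨆ T, U T : Submodule ℂ H) : Set H) := by
    have : x ∈ (⨆ T, U T).topologicalClosure := htop ▸ Submodule.mem_top
    exact this
  obtain ⟨y, hy, hxy⟩ := Metric.mem_closure_iff.1 hx ε hε
  obtain ⟨T, hT⟩ := (Submodule.mem_iSup_of_directed U hdir).1 hy
  refine ⟨T.1, T.2, ?_⟩
  have h2 : proj π (Subgroup.closure (T.1 : Set G)) x
      = proj π (Subgroup.closure (T.1 : Set G)) (x - y) := by
    rw [map_sub, proj_eq_zero hT, sub_zero]
  rw [h2]
  rw [dist_eq_norm] at hxy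
  exact (norm_proj_le _).trans_lt hxy

end Invariants

section Center

variable {G : Type*} [Group G] {H : Type*} [NormedAddCommGroup H] [InnerProductSpace ℂ H]

/-- `v` is the centre of the subgroup `F` for the cocycle `b`: on `F` the cocycle is the coboundary
of `v`, and `v` is orthogonal to the `F`-invariant vectors. In other words, `v` is the point closest
to the origin among the fixed points of `F` for the affine action `x ↦ π_g x + b g`. -/
structure IsCenter (π : G →* (H ≃ₗᵢ[ℂ] H)) (b : G → H) (F : Subgroup G) (v : H) : Prop where
  fixed : ∀ f ∈ F, b f = v - π f v
  orth : v ∈ (invariants π F)ᗮ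

variable {π : G →* (H ≃ₗᵢ[ℂ] H)} {b : G → H} {E F : Subgroup G} {v v' : H}

theorem IsCenter.unique (h : IsCenter π b F v) (h' : IsCenter π b F v') : v = v' := by
  have h1 : v - v' ∈ invariants π F := by
    intro f hf
    have h2 := h.fixed f hf
    rw [h'.fixed f hf] at h2
    change π f (v - v') = v - v'
    rw [map_sub, sub_eq_sub_iff_sub_eq_sub.1 h2.symm]
  have h2 : v - v' ∈ (invariants π F)ᗮ := Submodule.sub_mem _ h.orth h'.orth
  exact sub_eq_zero.1 (inner_self_eq_zero.1 ((Submodule.mem_orthogonal _ _).1 h2 _ h1))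

variable [CompleteSpace H]

/-- The mean of a cocycle over a finite subgroup is a fixed point of the affine action. -/
theorem exists_isCenter (hb : b ∈ oneCocycles π) (F : Subgroup G) [Finite F] :
    ∃ v, IsCenter π b F v := by
  have := Fintype.ofFinite F
  have hcard : (Fintype.card F : ℂ) ≠ 0 := Nat.cast_ne_zero.2 Fintype.card_ne_zero
  set m : H := (Fintype.card F : ℂ)⁻¹ • ∑ f : F, b f with hm
  have hfix : ∀ f ∈ F, b f = m - π f m := by
    intro f hf
    have h1 : ∑ f' : F, b (f * f') = ∑ f' : F, b f' :=
      Fintype.sum_equiv (Equiv.mulLeft (⟨f, hf⟩ : F)) _ _ fun _ => rfl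
    have h2 : ∑ f' : F, b (f * f') = Fintype.card F • b f + π f (∑ f' : F, b f') := by
      rw [Finset.sum_congr rfl fun (f' : F) _ => cocycle_mul hb f (f' : G), Finset.sum_add_distrib,
        Finset.sum_const, Finset.card_univ, map_sum]
    rw [h1, ← Nat.cast_smul_eq_nsmul ℂ] at h2
    rw [hm, map_smul, ← smul_sub, eq_inv_smul_iff₀ hcard, eq_sub_iff_add_eq]
    exact h2.symm
  refine ⟨m - proj π F m, fun f hf => ?_, sub_proj_mem m⟩
  rw [map_sub, mem_invariants.1 (proj_mem m) f hf, hfix f hf]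
  abel

theorem IsCenter.sub_proj_of_le (h : IsCenter π b F v) (hE : E ≤ F) :
    IsCenter π b E (v - proj π E v) where
  fixed f hf := by
    rw [map_sub, mem_invariants.1 (proj_mem v) f hf, h.fixed f (hE hf)]
    abel
  orth := sub_proj_mem v

theorem IsCenter.conj (hb : b ∈ oneCocycles π) (h : IsCenter π b F v) (g : G) :
    IsCenter π b (conj g F) (b g + π g v - proj π (UnitaryRep.conj g F) (b g)) where
  fixed f' hf' := by
    rw [map_sub, mem_invariants.1 (proj_mem (b g)) f' hf']
    obtain ⟨f, hf, rfl⟩ := mem_conj.1 hf'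
    rw [cocycle_mul hb, cocycle_mul hb, h.fixed f hf, cocycle_inv hb, map_add, map_neg,
      ← map_mul_apply, ← map_mul_apply, inv_mul_cancel_right, map_sub, map_mul_apply g f v]
    abel
  orth := by
    have h1 : proj π (UnitaryRep.conj g F) (b g + π g v) = proj π (UnitaryRep.conj g F) (b g) := by
      rw [map_add, proj_conj_map, proj_eq_zero h.orth, map_zero, add_zero]
    rw [← h1]
    exact sub_proj_mem _

/-- The error, at `g`, of the approximation of `b` by the coboundary of the centre of `F`. -/
theorem IsCenter.sub_coboundary (hb : b ∈ oneCocycles π) (h : IsCenter π b F v) (g : G)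
    (h' : IsCenter π b (UnitaryRep.conj g F) v') :
    b g - coboundary π v g = proj π (UnitaryRep.conj g F) (b g) + (v' - v) := by
  rw [h'.unique (h.conj hb g), coboundary]
  abel

theorem IsCenter.sub_coboundary_of_commute (hb : b ∈ oneCocycles π) (h : IsCenter π b F v) {g : G}
    (hg : ∀ f ∈ F, g * f = f * g) : b g - coboundary π v g = proj π F (b g) := by
  have h1 := conj_eq_of_commute hg
  rw [h.sub_coboundary hb g (h1.symm ▸ h), h1, sub_self, add_zero]

theorem IsCenter.sub_eq_proj {vE vF vK : H} (hE : IsCenter π b E vE) (hF : IsCenter π b F vF)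
    (hK : IsCenter π b (E ⊔ F) vK) (h : ∀ e ∈ E, ∀ f ∈ F, e * f = f * e) :
    vK - vE = proj π E vF := by
  have h' : ∀ f ∈ F, ∀ e ∈ E, f * e = e * f := fun f hf e he => (h e he f hf).symm
  rw [hE.unique (hK.sub_proj_of_le le_sup_left), hF.unique (hK.sub_proj_of_le le_sup_right),
    map_sub, ← proj_sup h', sup_comm F E, proj_eq_zero hK.orth]
  abel

end Center

end UnitaryRep

namespace UnitaryRep

/-! ### Subgroups generated by translates of a finite set -/

section Translates

variable {G : Type*} [Group G]

/-- The subgroup generated by the conjugates `tⁱ a t⁻ⁱ` with `i ∈ I` and `a ∈ T`. -/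
def translates (t : G) (T : Set G) (I : Set ℤ) : Subgroup G :=
  Subgroup.closure (Set.image2 (fun (i : ℤ) a => t ^ i * a * t ^ (-i)) I T)

variable {t : G} {T : Set G} {I J : Set ℤ}

theorem translates_mono (h : I ⊆ J) : translates t T I ≤ translates t T J :=
  Subgroup.closure_mono (Set.image2_subset_right h)

theorem translates_union : translates t T (I ∪ J) = translates t T I ⊔ translates t T J := by
  rw [translates, Set.image2_union_left, Subgroup.closure_union]
  rfl

theorem translates_singleton_zero : translates t T {0} = Subgroup.closure T := by
  simp [translates]

theorem conj_translates (n : ℤ) :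
    conj (t ^ n) (translates t T I) = translates t T ((fun i => i + n) '' I) := by
  rw [conj, translates, MonoidHom.map_closure, translates, Set.image_image2, Set.image2_image_left]
  congr 1
  refine Set.image2_congr fun i _ a _ => ?_
  simp only [MulEquiv.toMonoidHom_eq_coe, MonoidHom.coe_coe, MulAut.conj_apply]
  group

theorem translates_inv : translates t⁻¹ T I = translates t T (-I) := by
  rw [translates, translates, ← Set.image_neg_eq_neg, Set.image2_image_left]
  congr 1
  refine Set.image2_congr fun i _ a _ => ?_
  simp

theorem translates_le {A : Subgroup G} [A.Normal] (hT : T ⊆ A) : translates t T I ≤ A := by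
  rw [translates, Subgroup.closure_le]
  rintro x ⟨i, -, a, ha, rfl⟩
  simpa [zpow_neg] using ‹A.Normal›.conj_mem a (hT ha) (t ^ i)

theorem finite_translates {A : Subgroup G} [A.Normal] (hA : ∀ x ∈ A, ∀ y ∈ A, x * y = y * x)
    (htor : ∀ x ∈ A, IsOfFinOrder x) (hT : T ⊆ A) (hTf : T.Finite) (hI : I.Finite) :
    Finite (translates t T I) := by
  have hle := translates_le (t := t) (I := I) hT
  have hfg : Group.FG (translates t T I) :=
    (Group.fg_iff_subgroup_fg _).2 ((Subgroup.fg_iff _).2 ⟨_, rfl, hI.image2 _ hTf⟩)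
  let _ : CommGroup (translates t T I) :=
    { mul_comm := fun x y => Subtype.ext (hA x (hle x.2) y (hle y.2)) }
  refine CommGroup.finite_of_fg_isMulTorsion _ fun x => ?_
  exact Submonoid.isOfFinOrder_coe.1 (htor x (hle x.2))

end Translates

section Bound

variable {G : Type*} [Group G] {H : Type*} [NormedAddCommGroup H] [InnerProductSpace ℂ H]
  [CompleteSpace H] {π : G →* (H ≃ₗᵢ[ℂ] H)} {b : G → H} {t : G} {T : Set G} {A : Subgroup G}
  [A.Normal]

theorem translates_comm (hA : ∀ x ∈ A, ∀ y ∈ A, x * y = y * x) (hT : T ⊆ A) (I J : Set ℤ) :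
    ∀ x ∈ translates t T I, ∀ y ∈ translates t T J, x * y = y * x :=
  fun x hx y hy => hA x (translates_le hT hx) y (translates_le hT hy)

/-- The pieces of a vector that are invariant under the translates of index `0, …, l - 1` and
orthogonal to the invariants of the translate of index `l` are mutually orthogonal. -/
theorem sum_norm_proj_sub_le (hA : ∀ x ∈ A, ∀ y ∈ A, x * y = y * x) (hT : T ⊆ A) (x : H) (j : ℕ) :
    ∑ i ∈ Finset.range j, ‖proj π (translates t T (Set.Ico 0 ((j - i : ℕ) : ℤ)))
      (x - proj π (translates t T {((j - i : ℕ) : ℤ)}) x)‖ ≤ √j * ‖x‖ := by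
  set β : ℕ → ℝ := fun l => ‖proj π (translates t T (Set.Ico 0 (l : ℤ)))
    (x - proj π (translates t T {(l : ℤ)}) x)‖ with hβ
  set γ : ℕ → ℝ := fun l => ‖proj π (translates t T (Set.Ico 0 ((l + 1 : ℕ) : ℤ))) x‖ ^ 2 with hγ
  have h1 : ∑ i ∈ Finset.range j, β (j - i) = ∑ i ∈ Finset.range j, β (i + 1) := by
    rw [← Finset.sum_range_reflect]
    refine Finset.sum_congr rfl fun i hi => ?_
    rw [Finset.mem_range] at hi
    congr 1
    omega
  have h2 : ∀ l, β (l + 1) ^ 2 = γ l - γ (l + 1) := by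
    intro l
    have h3 : translates t T (Set.Ico 0 ((l + 1 + 1 : ℕ) : ℤ)) =
        translates t T {((l + 1 : ℕ) : ℤ)} ⊔ translates t T (Set.Ico 0 ((l + 1 : ℕ) : ℤ)) := by
      rw [← translates_union]
      congr 1
      ext i
      simp only [Set.mem_Ico, Set.mem_union, Set.mem_singleton_iff]
      push_cast
      omega
    have h4 := proj_sup (π := π) (translates_comm (t := t) hA hT {((l + 1 : ℕ) : ℤ)}
      (Set.Ico 0 ((l + 1 : ℕ) : ℤ))) x
    rw [← h3] at h4
    simp only [hβ, hγ]
    rw [map_sub, ← h4, ← proj_proj_of_le (E := translates t T (Set.Ico 0 ((l + 1 : ℕ) : ℤ)))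
      (F := translates t T (Set.Ico 0 ((l + 1 + 1 : ℕ) : ℤ))) (h3 ▸ le_sup_right),
      norm_sub_proj_sq]
  have h5 : ∑ i ∈ Finset.range j, β (i + 1) ^ 2 ≤ ‖x‖ ^ 2 := by
    simp only [h2]
    rw [Finset.sum_range_sub']
    have h6 : γ 0 ≤ ‖x‖ ^ 2 := pow_le_pow_left₀ (norm_nonneg _) (norm_proj_le x) 2
    have h7 : 0 ≤ γ j := sq_nonneg _
    linarith
  have h6 := sq_sum_le_card_mul_sum_sq (s := Finset.range j) (f := fun i => β (i + 1))
  rw [Finset.card_range] at h6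
  change ∑ i ∈ Finset.range j, β (j - i) ≤ _
  rw [h1]
  refine abs_le_of_sq_le_sq' ?_ (by positivity) |>.2
  rw [mul_pow, Real.sq_sqrt (Nat.cast_nonneg j)]
  exact h6.trans (mul_le_mul_of_nonneg_left h5 (Nat.cast_nonneg j))

/-- The centre of the translate of index `j` by itself may have norm of order `j`. Its part
invariant under the translates of index `0, …, j - 1` only has norm `O(√j)`. -/
theorem norm_proj_center_le (hb : b ∈ oneCocycles π) (hA : ∀ x ∈ A, ∀ y ∈ A, x * y = y * x)
    (hT : T ⊆ A) (j : ℕ) {v₀ v : H} (h₀ : IsCenter π b (translates t T {0}) v₀)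
    (h : IsCenter π b (translates t T {(j : ℤ)}) v) {L : Subgroup G}
    (hL : translates t T (Set.Ico 0 (j : ℤ)) ≤ L) :
    ‖proj π L v‖ ≤ ‖v₀‖ + √j * ‖b t‖ := by
  refine (norm_proj_le_of_le hL v).trans ?_
  have hc : conj (t ^ j) (translates t T {0}) = translates t T {(j : ℤ)} := by
    rw [← zpow_natCast, conj_translates]
    simp
  have hv : v = π (t ^ j) v₀ + (b (t ^ j) - proj π (translates t T {(j : ℤ)}) (b (t ^ j))) := by
    have h1 := h₀.conj hb (t ^ j)
    rw [hc] at h1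
    rw [h.unique h1]
    abel
  rw [hv, map_add]
  refine (norm_add_le _ _).trans (add_le_add ((norm_proj_le _).trans
    (LinearIsometryEquiv.norm_map _ _).le) ?_)
  rw [cocycle_pow hb, map_sum, ← Finset.sum_sub_distrib, map_sum]
  refine (norm_sum_le _ _).trans ((Finset.sum_le_sum fun i hi => ?_).trans
    (sum_norm_proj_sub_le (π := π) (t := t) hA hT (b t) j))
  rw [Finset.mem_range] at hi
  have h1 : translates t T {(j : ℤ)} = conj (t ^ i) (translates t T {((j - i : ℕ) : ℤ)}) := by
    rw [← zpow_natCast, conj_translates, Set.image_singleton]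
    congr 2
    omega
  have h2 : translates t T (Set.Ico 0 (j : ℤ)) =
      conj (t ^ i) (translates t T (Set.Ico (-i : ℤ) ((j - i : ℕ) : ℤ))) := by
    rw [← zpow_natCast, conj_translates, Set.image_add_const_Ico]
    congr 2 <;> omega
  rw [h1, h2, proj_conj_map, ← map_sub, proj_conj_map, LinearIsometryEquiv.norm_map]
  exact norm_proj_le_of_le (translates_mono (Set.Ico_subset_Ico_left (by omega))) _

end Bound

section Weights

variable {H : Type*} [NormedAddCommGroup H] [InnerProductSpace ℂ H]

/-- Averages of orthogonal vectors with norms `O(√n)`, with weights `1 / n`, are small. -/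
theorem norm_weighted_sum_le {d : ℕ → H} {K : ℝ} (hK : 0 ≤ K)
    (horth : ∀ m n, m < n → inner ℂ (d m) (d n) = 0) (hd : ∀ n, ‖d n‖ ≤ K * √((n : ℝ) + 1))
    (N : ℕ) :
    ‖∑ n ∈ Finset.range N, ((1 / ((n : ℝ) + 1) : ℝ) : ℂ) • d n‖ ≤
      K * √(∑ n ∈ Finset.range N, 1 / ((n : ℝ) + 1)) := by
  have key : ‖∑ n ∈ Finset.range N, ((1 / ((n : ℝ) + 1) : ℝ) : ℂ) • d n‖ ^ 2 ≤
      K ^ 2 * ∑ n ∈ Finset.range N, 1 / ((n : ℝ) + 1) := by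
    induction N with
    | zero => simp
    | succ N ih =>
      rw [Finset.sum_range_succ, Finset.sum_range_succ, mul_add]
      have h0 : inner ℂ (∑ n ∈ Finset.range N, ((1 / ((n : ℝ) + 1) : ℝ) : ℂ) • d n)
          (((1 / ((N : ℝ) + 1) : ℝ) : ℂ) • d N) = 0 := by
        rw [sum_inner]
        refine Finset.sum_eq_zero fun n hn => ?_
        rw [inner_smul_left, inner_smul_right, horth n N (Finset.mem_range.1 hn), mul_zero,
          mul_zero]
      have h1 := norm_add_sq_eq_norm_sq_add_norm_sq_of_inner_eq_zero _ _ h0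
      rw [← sq, ← sq, ← sq] at h1
      rw [h1]
      refine add_le_add ih ?_
      have hN : (0 : ℝ) < (N : ℝ) + 1 := by positivity
      rw [norm_smul, Complex.norm_real, Real.norm_of_nonneg (by positivity), mul_pow]
      have h2 : ‖d N‖ ^ 2 ≤ K ^ 2 * ((N : ℝ) + 1) := by
        have := pow_le_pow_left₀ (norm_nonneg _) (hd N) 2
        rwa [mul_pow, Real.sq_sqrt hN.le] at this
      calc (1 / ((N : ℝ) + 1)) ^ 2 * ‖d N‖ ^ 2
          ≤ (1 / ((N : ℝ) + 1)) ^ 2 * (K ^ 2 * ((N : ℝ) + 1)) := by gcongr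
        _ = K ^ 2 * (1 / ((N : ℝ) + 1)) := by field_simp
  have hs : (0 : ℝ) ≤ ∑ n ∈ Finset.range N, 1 / ((n : ℝ) + 1) :=
    Finset.sum_nonneg fun n _ => by positivity
  refine abs_le_of_sq_le_sq' ?_ (by positivity) |>.2
  rwa [mul_pow, Real.sq_sqrt hs]

end Weights

end UnitaryRep

namespace UnitaryRep

/-! ### Vanishing of reduced cohomology without vectors invariant under a central subgroup -/

section Vanishing

variable {G : Type*} [Group G] {H : Type*} [NormedAddCommGroup H] [InnerProductSpace ℂ H]
  [CompleteSpace H] {π : G →* (H ≃ₗᵢ[ℂ] H)} {b : G → H} {t : G} {T : Set G}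

/-- Two centres of an increasing sequence of subgroups differ by orthogonal increments. -/
theorem inner_center_sub_eq_zero {E F E' F' : Subgroup G} {vE vF vE' vF' : H}
    (hE : IsCenter π b E vE) (hF : IsCenter π b F vF) (hE' : IsCenter π b E' vE')
    (hF' : IsCenter π b F' vF') (h : E ≤ F) (h' : E' ≤ F') (hle : F ≤ E') :
    inner ℂ (vF - vE) (vF' - vE') = 0 := by
  have h1 : vF - vE ∈ (invariants π F)ᗮ :=
    Submodule.sub_mem _ hF.orth (Submodule.orthogonal_le (invariants_anti h) hE.orth)
  refine (Submodule.mem_orthogonal' _ _).1 h1 _ (invariants_anti hle ?_)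
  rw [hE'.unique (hF'.sub_proj_of_le h'), sub_sub_cancel]
  exact proj_mem _

theorem sqrt_natCast_add_two_le (n : ℕ) : √((n + 2 : ℕ) : ℝ) ≤ 2 * √((n : ℝ) + 1) := by
  rw [show (2 : ℝ) * √((n : ℝ) + 1) = √(4 * ((n : ℝ) + 1)) by
    rw [Real.sqrt_mul (by norm_num), show (4 : ℝ) = 2 ^ 2 by norm_num, Real.sqrt_sq (by norm_num)]]
  refine Real.sqrt_le_sqrt ?_
  push_cast
  linarith [(Nat.cast_nonneg n : (0 : ℝ) ≤ n)]

/-- Increments of the centres along a growing sequence of intervals: the interval `[-n, n + 1]` is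
enlarged on the right, or on the left, by one element. -/
theorem exists_norm_center_sub_le {A : Subgroup G} [A.Normal] (hb : b ∈ oneCocycles π)
    (hA : ∀ x ∈ A, ∀ y ∈ A, x * y = y * x) (hT : T ⊆ A) {v : Set ℤ → H}
    (hv : ∀ I : Set ℤ, I.Finite → IsCenter π b (translates t T I) (v I)) :
    ∃ K : ℝ, 0 ≤ K ∧ ∀ n : ℕ,
      ‖v (Set.Icc (-n : ℤ) (n + 1) ∪ {(n + 2 : ℤ)}) - v (Set.Icc (-n : ℤ) (n + 1))‖
        ≤ K * √((n : ℝ) + 1) ∧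
      ‖v (Set.Icc (-n : ℤ) (n + 1) ∪ {-(n + 1 : ℤ)}) - v (Set.Icc (-n : ℤ) (n + 1))‖
        ≤ K * √((n : ℝ) + 1) := by
  refine ⟨2 * (‖v {0}‖ + ‖b t‖), by positivity, fun n => ?_⟩
  have hsub : ∀ j : ℤ, v (Set.Icc (-n : ℤ) (n + 1) ∪ {j}) - v (Set.Icc (-n : ℤ) (n + 1)) =
      proj π (translates t T (Set.Icc (-n : ℤ) (n + 1))) (v {j}) := fun j =>
    (hv _ (Set.finite_Icc _ _)).sub_eq_proj (hv {j} (Set.finite_singleton j))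
      (translates_union (t := t) ▸ hv _ ((Set.finite_Icc _ _).union (Set.finite_singleton j)))
      (translates_comm hA hT _ _)
  have h1 : (1 : ℝ) ≤ √((n : ℝ) + 1) :=
    Real.one_le_sqrt.2 (by linarith [(Nat.cast_nonneg n : (0 : ℝ) ≤ n)])
  have hbound : ∀ j : ℕ, j ≤ n + 2 →
      ‖v {0}‖ + √(j : ℝ) * ‖b t‖ ≤ 2 * (‖v {0}‖ + ‖b t‖) * √((n : ℝ) + 1) := by
    intro j hj
    have h2 : √(j : ℝ) ≤ 2 * √((n : ℝ) + 1) :=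
      (Real.sqrt_le_sqrt (by exact_mod_cast hj)).trans (sqrt_natCast_add_two_le n)
    have h3 := mul_le_mul_of_nonneg_right h2 (norm_nonneg (b t))
    have h4 := mul_le_mul_of_nonneg_left h1 (norm_nonneg (v {0}))
    nlinarith [norm_nonneg (v {0}), norm_nonneg (b t)]
  rw [hsub, hsub]
  constructor
  · refine (norm_proj_center_le hb hA hT (n + 2) (hv {0} (Set.finite_singleton 0))
      (by simpa using hv {(n + 2 : ℤ)} (Set.finite_singleton _)) (translates_mono ?_)).trans
      (hbound _ le_rfl)
    intro i hi
    simp only [Set.mem_Ico, Set.mem_Icc] at hi ⊢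
    push_cast at hi
    omega
  · have hinv : ‖b t⁻¹‖ = ‖b t‖ := by
      rw [cocycle_inv hb, norm_neg, LinearIsometryEquiv.norm_map]
    rw [← hinv] at hbound
    rw [← hinv]
    refine (norm_proj_center_le (t := t⁻¹) hb hA hT (n + 1) ?_ ?_ ?_).trans (hbound _ (by omega))
    · simpa [translates_inv] using hv {0} (Set.finite_singleton 0)
    · rw [translates_inv]
      simpa [add_comm] using hv {-(n + 1 : ℤ)} (Set.finite_singleton _)
    · rw [translates_inv]
      refine translates_mono ?_
      intro i hi
      simp only [Set.mem_neg, Set.mem_Ico, Set.mem_Icc] at hi ⊢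
      push_cast at hi
      omega

/-- If `A` is a torsion normal subgroup that is central in `N`, and `G` is generated by `N` and one
more element, then the representations without non-zero `A`-invariant vectors have vanishing
reduced cohomology. The approximating coboundaries are those of averages, with weights `1 / n`, of
the centres of the subgroups generated by the translates of index `-n, …, n` of a large finite
subset of `A`. -/
theorem vanishes_of_central_torsion {A N : Subgroup G} [A.Normal] {S : Set G} (hSf : S.Finite)
    (hS : S ⊆ N ∪ {t}) (hgen : Subgroup.closure S = ⊤) (hAN : A ≤ N)
    (hcen : ∀ y ∈ N, ∀ a ∈ A, y * a = a * y) (htor : ∀ a ∈ A, IsOfFinOrder a)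
    (hinv : invariants π A = ⊥) : ReducedH1Vanishes π := by
  classical
  intro b hb
  have hA : ∀ x ∈ A, ∀ y ∈ A, x * y = y * x := fun x hx => hcen x (hAN hx)
  refine mem_closure_of_approx hgen hb fun ε hε => ?_
  obtain ⟨T, hTA, hTf, hT⟩ : ∃ T : Set G, T ⊆ A ∧ T.Finite ∧
      ∀ s ∈ S, ‖proj π (translates t T {0}) (b s)‖ ≤ ε / 2 := by
    choose T hT hTε using fun s => exists_finset_norm_proj_lt hinv (b s) (half_pos hε)
    refine ⟨⋃ s ∈ S, (T s : Set G), Set.iUnion₂_subset fun s _ => hT s,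
      hSf.biUnion fun s _ => (T s).finite_toSet, fun s hs => ?_⟩
    rw [translates_singleton_zero]
    exact (norm_proj_le_of_le (Subgroup.closure_mono
      (Set.subset_biUnion_of_mem (u := fun s => (T s : Set G)) hs)) _).trans (hTε s).le
  have hex : ∀ I : Set ℤ, ∃ v, I.Finite → IsCenter π b (translates t T I) v := by
    intro I
    by_cases hI : I.Finite
    · have := finite_translates (t := t) hA htor hTA hTf hI
      obtain ⟨v, hv⟩ := exists_isCenter hb (translates t T I)
      exact ⟨v, fun _ => hv⟩
    · exact ⟨0, fun h => absurd h hI⟩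
  choose v hv using hex
  obtain ⟨K, hK, hd⟩ := exists_norm_center_sub_le hb hA hTA hv
  set J : ℕ → Set ℤ := fun n => Set.Icc (-n : ℤ) (n + 1) with hJ
  have hJf : ∀ n, (J n).Finite := fun n => Set.finite_Icc _ _
  have hJf' : ∀ n j, (J n ∪ {j}).Finite := fun n j => (hJf n).union (Set.finite_singleton j)
  have hsmall : ∀ I : Set ℤ, (0 : ℤ) ∈ I → ∀ s ∈ S, ‖proj π (translates t T I) (b s)‖ ≤ ε / 2 :=
    fun I hI s hs => (norm_proj_le_of_le (translates_mono (by simpa using hI)) _).trans (hT s hs)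
  obtain ⟨N', hN'⟩ := (Real.tendsto_sum_range_one_div_nat_succ_atTop.eventually_ge_atTop
    ((4 * K / ε) ^ 2 + 1)).exists
  set Λ : ℝ := ∑ n ∈ Finset.range N', 1 / ((n : ℝ) + 1) with hΛ
  have hΛ0 : 0 < Λ := by linarith [sq_nonneg (4 * K / ε)]
  set c : ℕ → ℂ := fun n => ((1 / ((n : ℝ) + 1) : ℝ) : ℂ) with hc
  have hcΛ : ∑ n ∈ Finset.range N', c n = (Λ : ℂ) := by
    rw [hΛ, Complex.ofReal_sum]
  have hcnorm : ∀ n, ‖c n‖ = 1 / ((n : ℝ) + 1) := fun n => by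
    rw [hc, Complex.norm_real, Real.norm_of_nonneg (by positivity)]
  have hcΛ0 : ∑ n ∈ Finset.range N', c n ≠ 0 := by
    rw [hcΛ]
    exact_mod_cast hΛ0.ne'
  -- an average of vectors of norm at most `ε / 2`
  have havg : ∀ e : ℕ → H, (∀ n, ‖e n‖ ≤ ε / 2) →
      ‖∑ n ∈ Finset.range N', c n • e n‖ ≤ Λ * (ε / 2) := by
    intro e he
    refine (norm_sum_le _ _).trans ?_
    rw [hΛ, Finset.sum_mul]
    refine Finset.sum_le_sum fun n _ => ?_
    rw [norm_smul, hcnorm]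
    exact mul_le_mul_of_nonneg_left (he n) (by positivity)
  refine ⟨(∑ n ∈ Finset.range N', c n)⁻¹ •
    ∑ n ∈ Finset.range N', c n • v (J n ∪ {-(n + 1 : ℤ)}), fun s hs => ?_⟩
  rw [sub_coboundary_weighted hcΛ0 (fun n => v (J n ∪ {-(n + 1 : ℤ)})) s, hcΛ, norm_smul, norm_inv,
    Complex.norm_real, Real.norm_of_nonneg hΛ0.le, inv_mul_le_iff₀ hΛ0]
  have h0J : ∀ n, (0 : ℤ) ∈ J n := fun n => by
    simp only [hJ, Set.mem_Icc]
    omega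
  rcases hS hs with hsN | hst
  · have h1 : ∀ n, b s - coboundary π (v (J n ∪ {-(n + 1 : ℤ)})) s =
        proj π (translates t T (J n ∪ {-(n + 1 : ℤ)})) (b s) := fun n =>
      (hv _ (hJf' n _)).sub_coboundary_of_commute hb fun f hf =>
        hcen s hsN f (translates_le hTA hf)
    simp only [h1]
    refine (havg _ fun n => hsmall _ (Or.inl (h0J n)) s hs).trans ?_
    nlinarith
  · obtain rfl : s = t := hst
    have h1 : ∀ n, b s - coboundary π (v (J n ∪ {-(n + 1 : ℤ)})) s =
        proj π (translates s T (J n ∪ {(n + 2 : ℤ)})) (b s) +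
          ((v (J n ∪ {(n + 2 : ℤ)}) - v (J n)) - (v (J n ∪ {-(n + 1 : ℤ)}) - v (J n))) := by
      intro n
      have h2 : conj s (translates s T (J n ∪ {-(n + 1 : ℤ)})) =
          translates s T (J n ∪ {(n + 2 : ℤ)}) := by
        have h3 := conj_translates (t := s) (T := T) (I := J n ∪ {-(n + 1 : ℤ)}) 1
        rw [zpow_one] at h3
        rw [h3]
        congr 1
        ext i
        simp only [hJ, Set.mem_image, Set.mem_union, Set.mem_Icc, Set.mem_singleton_iff]
        constructor
        · rintro ⟨j, hj, rfl⟩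
          omega
        · intro hi
          exact ⟨i - 1, by omega, by omega⟩
      rw [(hv _ (hJf' n _)).sub_coboundary hb s (h2.symm ▸ hv _ (hJf' n _)), h2]
      abel
    simp only [h1, smul_add, smul_sub, Finset.sum_add_distrib, Finset.sum_sub_distrib]
    have hmono : ∀ n j, translates s T (J n) ≤ translates s T (J n ∪ {j}) := fun n j =>
      translates_mono Set.subset_union_left
    have horth : ∀ j : ℕ → ℤ, (∀ m n : ℕ, m < n → J m ∪ {j m} ⊆ J n) → ∀ m n, m < n →
        inner ℂ (v (J m ∪ {j m}) - v (J m)) (v (J n ∪ {j n}) - v (J n)) = 0 :=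
      fun j hj m n hmn => inner_center_sub_eq_zero (hv _ (hJf m)) (hv _ (hJf' m _))
        (hv _ (hJf n)) (hv _ (hJf' n _)) (hmono m _) (hmono n _) (translates_mono (hj m n hmn))
    have h2 := norm_weighted_sum_le hK (horth (fun n => n + 2) (by
      intro m n hmn i
      simp only [hJ, Set.mem_union, Set.mem_Icc, Set.mem_singleton_iff]
      omega)) (fun n => (hd n).1) N'
    have h3 := norm_weighted_sum_le hK (horth (fun n => -(n + 1)) (by
      intro m n hmn i
      simp only [hJ, Set.mem_union, Set.mem_Icc, Set.mem_singleton_iff]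
      omega)) (fun n => (hd n).2) N'
    simp only [smul_sub, Finset.sum_sub_distrib] at h2 h3
    have h4 := havg _ fun n => hsmall (J n ∪ {(n + 2 : ℤ)}) (Or.inl (h0J n)) s hs
    refine (norm_add_le _ _).trans ((add_le_add h4 ((norm_sub_le _ _).trans
      (add_le_add h2 h3))).trans ?_)
    rw [← hΛ]
    have h5 : 4 * K / ε ≤ √Λ := Real.le_sqrt_of_sq_le (by linarith)
    rw [div_le_iff₀ hε] at h5
    have h6 : √Λ * √Λ = Λ := Real.mul_self_sqrt hΛ0.le
    nlinarith [Real.sqrt_nonneg Λ]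

end Vanishing

end UnitaryRep

namespace UnitaryRep

/-! ### Vanishing of reduced cohomology along a central series -/

section Chain

open scoped commutatorElement

variable {G : Type*} [Group G] {t : G} {S : Set G}

/-- The mean ergodic theorem: if `G` is generated by one element and a torsion subgroup that acts
trivially, then the reduced cohomology vanishes in the absence of invariant vectors. -/
theorem vanishes_of_mean_ergodic {H : Type*} [NormedAddCommGroup H] [InnerProductSpace ℂ H]
    [CompleteSpace H] {π : G →* (H ≃ₗᵢ[ℂ] H)} {N : Subgroup G} (hS : S ⊆ N ∪ {t})
    (hgen : Subgroup.closure S = ⊤) (hN : N ≤ π.ker) (htor : ∀ y ∈ N, IsOfFinOrder y)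
    (hinv : invariants π ⊤ = ⊥) : ReducedH1Vanishes π := by
  intro b hb
  refine mem_closure_of_approx hgen hb fun ε hε => ?_
  let R : Submodule ℂ H :=
    LinearMap.range (LinearMap.id - ((π t).toLinearEquiv : H →ₗ[ℂ] H))
  have hR : R.topologicalClosure = ⊤ := by
    rw [Submodule.topologicalClosure_eq_top_iff, eq_bot_iff, ← hinv]
    intro y hy
    have h1 : inner ℂ (y - π t y) y = 0 := (Submodule.mem_orthogonal _ _).1 hy _ ⟨y, rfl⟩
    have h2 : π t y = y := by
      rw [inner_sub_left, sub_eq_zero] at h1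
      refine sub_eq_zero.1 (norm_eq_zero.1 (pow_eq_zero_iff two_ne_zero |>.1 ?_))
      rw [@norm_sub_sq ℂ, ← h1, LinearIsometryEquiv.norm_map, inner_self_eq_norm_sq]
      ring
    rw [mem_invariants_iff_le, ← hgen, Subgroup.closure_le]
    intro s hs
    rcases hS hs with hs | rfl
    · have h3 : π s = 1 := hN hs
      change π s y = y
      rw [h3]
      rfl
    · exact h2
  have hbt : b t ∈ closure (R : Set H) := by
    have : b t ∈ R.topologicalClosure := hR ▸ Submodule.mem_top
    exact this
  obtain ⟨_, ⟨w, rfl⟩, hw⟩ := Metric.mem_closure_iff.1 hbt ε hε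
  refine ⟨w, fun s hs => ?_⟩
  rcases hS hs with hs | rfl
  · have h3 : π s = 1 := hN hs
    rw [cocycle_eq_zero_of_isOfFinOrder hb (htor s hs) h3, coboundary, h3]
    simpa using hε.le
  · rw [dist_eq_norm] at hw
    exact hw.le

theorem invariants_invariant {H : Type*} [NormedAddCommGroup H] [InnerProductSpace ℂ H]
    (π : G →* (H ≃ₗᵢ[ℂ] H)) (F : Subgroup G) [hF : F.Normal] (g : G) :
    ∀ w ∈ invariants π F, π g w ∈ invariants π F := by
  intro w hw f hf
  change π f (π g w) = π g w
  have h1 := mem_invariants.1 hw _ (hF.conj_mem f hf g⁻¹)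
  nth_rewrite 2 [← h1]
  rw [← map_mul_apply, ← map_mul_apply]
  congr 2
  group

/-- Let `M 0 ≥ M 1 ≥ … ≥ M k = 1` be a central series of `M 0` with factors of exponent `q`, normal
in `G`, where `G` is generated by finitely many elements of `M 0` and one more element. Then the
representations of `G` without non-zero invariant vectors have vanishing reduced cohomology. -/
theorem vanishes_of_central_series {q : ℕ} (hq : 0 < q) (M : ℕ → Subgroup G)
    (hM : ∀ j, (M j).Normal) (hanti : Antitone M) {k : ℕ} (hk : M k = ⊥)
    (hcomm : ∀ j, ∀ a ∈ M j, ∀ y ∈ M 0, ⁅a, y⁆ ∈ M (j + 1))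
    (hpow : ∀ j, ∀ a ∈ M j, a ^ q ∈ M (j + 1))
    (hSf : S.Finite) (hS : S ⊆ M 0 ∪ {t}) (hgen : Subgroup.closure S = ⊤)
    {H : Type*} [NormedAddCommGroup H] [InnerProductSpace ℂ H]
    [CompleteSpace H] {π : G →* (H ≃ₗᵢ[ℂ] H)} (hinv : invariants π ⊤ = ⊥) :
    ReducedH1Vanishes π := by
  have hpow' : ∀ n, ∀ a ∈ M 0, a ^ q ^ n ∈ M n := by
    intro n a ha
    induction n with
    | zero => simpa using ha
    | succ n ih =>
      rw [pow_succ, pow_mul]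
      exact hpow n _ ih
  have htor : ∀ j, ∀ a ∈ M j, IsOfFinOrder a := fun j a ha =>
    isOfFinOrder_iff_pow_eq_one.2 ⟨q ^ k, pow_pos hq k, by
      have := hpow' k a (hanti (Nat.zero_le j) ha)
      rwa [hk, Subgroup.mem_bot] at this⟩
  suffices h : ∀ j, ∀ (H : Type _) [NormedAddCommGroup H] [InnerProductSpace ℂ H] [CompleteSpace H]
      (π : G →* (H ≃ₗᵢ[ℂ] H)), M j ≤ π.ker → invariants π ⊤ = ⊥ → ReducedH1Vanishes π from
    h k H π (hk ▸ bot_le) hinv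
  intro j
  induction j with
  | zero => exact fun H _ _ _ π hker hinv => vanishes_of_mean_ergodic hS hgen hker (htor 0) hinv
  | succ j ih =>
    intro H _ _ _ π hker hinv
    have hW := invariants_invariant π (M j)
    refine vanishes_of_restrict (W := invariants π (M j)) hW (ih _ _ ?_ ?_) ?_
    · intro a ha
      ext x
      exact x.2 ha
    · rw [eq_bot_iff]
      intro x hx
      have h1 : (x : H) ∈ invariants π ⊤ := fun g hg => congrArg Subtype.val (hx hg)
      rw [hinv, Submodule.mem_bot] at h1
      exact (Submodule.mem_bot ℂ).2 (Subtype.ext h1)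
    · have hker' : M (j + 1) ≤ (restrict π (invariants π (M j))ᗮ (orthogonal_invariant hW)).ker := by
        intro a ha
        have h1 : π a = 1 := hker ha
        ext x
        change π a x = x
        rw [h1]
        rfl
      refine vanishes_of_quotient hker' (htor (j + 1)) ?_
      have hsurj := QuotientGroup.mk'_surjective (M (j + 1))
      have hA : ((M j).map (QuotientGroup.mk' (M (j + 1)))).Normal := (hM j).map _ hsurj
      refine vanishes_of_central_torsion (A := (M j).map (QuotientGroup.mk' (M (j + 1))))
        (N := (M 0).map (QuotientGroup.mk' (M (j + 1)))) (t := QuotientGroup.mk' _ t)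
        (S := QuotientGroup.mk' (M (j + 1)) '' S) (hSf.image _) ?_ ?_
        (Subgroup.map_mono (hanti (Nat.zero_le j))) ?_ ?_ ?_
      · rintro _ ⟨s, hs, rfl⟩
        rcases hS hs with hs | rfl
        · exact Or.inl (Subgroup.mem_map_of_mem _ hs)
        · exact Or.inr rfl
      · rw [← MonoidHom.map_closure, hgen, Subgroup.map_top_of_surjective _ hsurj]
      · rintro _ ⟨y, hy, rfl⟩ _ ⟨a, ha, rfl⟩
        refine (commutatorElement_eq_one_iff_mul_comm.1 ?_).symm
        rw [← map_commutatorElement]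
        exact (QuotientGroup.eq_one_iff _).2 (hcomm j a ha y hy)
      · rintro _ ⟨a, ha, rfl⟩
        exact MonoidHom.isOfFinOrder _ (htor j a ha)
      · rw [eq_bot_iff]
        intro x hx
        have h1 : (x : H) ∈ invariants π (M j) := fun a ha =>
          congrArg Subtype.val (hx (Subgroup.mem_map_of_mem (QuotientGroup.mk' (M (j + 1))) ha))
        exact (Submodule.mem_bot ℂ).2 (Subtype.ext (inner_self_eq_zero.1 (x.2 _ h1)))

end Chain

end UnitaryRep

namespace Gromov

/-! ### Left-normed commutators of generators -/

section LeftNormed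

open scoped commutatorElement

variable {ι Γ : Type*} [Group Γ] {a : ι → Γ}

theorem leftCommutator_concat {l : List Γ} (hl : l ≠ []) (y : Γ) :
    leftCommutator (l ++ [y]) = ⁅leftCommutator l, y⁆ := by
  cases l with
  | nil => exact absurd rfl hl
  | cons g l => simp [leftCommutator, commutatorElement_def]

theorem leftCommutator_append_eq_one {l : List Γ} (hl : l ≠ []) (h : leftCommutator l = 1)
    (l' : List Γ) : leftCommutator (l ++ l') = 1 := by
  induction l' using List.reverseRecOn with
  | nil => simpa using h
  | append_singleton l' y ih =>
    rw [← List.append_assoc, leftCommutator_concat (by simp [hl]), ih, commutatorElement_one_left]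

variable (a) in
/-- The normal closure of the left-normed commutators of length `j + 1` in the elements `a i`. When
these elements generate the group, it is the `j`-th term of the lower central series. -/
def lowerTerm (j : ℕ) : Subgroup Γ :=
  Subgroup.normalClosure {x | ∃ l : List ι, l.length = j + 1 ∧ x = leftCommutator (l.map a)}

instance (j : ℕ) : (lowerTerm a j).Normal := Subgroup.normalClosure_normal

theorem leftCommutator_mem_lowerTerm {l : List ι} {j : ℕ} (hl : l.length = j + 1) :
    leftCommutator (l.map a) ∈ lowerTerm a j :=
  Subgroup.subset_normalClosure ⟨l, hl, rfl⟩

theorem exists_leftCommutator_eq {l : List ι} {j : ℕ} (hl : l.length = j + 2) :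
    ∃ (l' : List ι) (i : ι), l'.length = j + 1 ∧
      leftCommutator (l.map a) = ⁅leftCommutator (l'.map a), a i⁆ := by
  have hne : l ≠ [] := by
    rintro rfl
    simp at hl
  refine ⟨l.dropLast, l.getLast hne, by simp [hl], ?_⟩
  have hne' : l.dropLast.map a ≠ [] := by
    intro h
    have := congrArg List.length h
    simp [hl] at this
  rw [← leftCommutator_concat hne', ← List.map_singleton, ← List.map_append,
    List.dropLast_append_getLast hne]

theorem lowerTerm_antitone : Antitone (lowerTerm a) := by
  refine antitone_nat_of_succ_le fun j => Subgroup.normalClosure_le_normal ?_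
  rintro x ⟨l, hl, rfl⟩
  obtain ⟨l', i, hl', h⟩ := exists_leftCommutator_eq (a := a) hl
  have hu : leftCommutator (l'.map a) ∈ lowerTerm a j := leftCommutator_mem_lowerTerm hl'
  rw [h, commutatorElement_def, mul_assoc, mul_assoc, ← mul_assoc (a i)]
  exact Subgroup.mul_mem _ hu
    ((inferInstance : (lowerTerm a j).Normal).conj_mem _ (Subgroup.inv_mem _ hu) _)

theorem lowerTerm_zero (ha : Subgroup.closure (Set.range a) = ⊤) : lowerTerm a 0 = ⊤ := by
  rw [eq_top_iff, ← ha, Subgroup.closure_le]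
  rintro _ ⟨i, rfl⟩
  exact leftCommutator_mem_lowerTerm (l := [i]) rfl

theorem lowerTerm_eq_bot {j : ℕ}
    (h : ∀ l : List ι, l.length = j + 1 → leftCommutator (l.map a) = 1) : lowerTerm a j = ⊥ := by
  rw [eq_bot_iff]
  refine Subgroup.normalClosure_le_normal ?_
  rintro x ⟨l, hl, rfl⟩
  exact h l hl

theorem map_lowerTerm_le {f : Γ →* Γ} (hf : ∀ i, ∃ i', f (a i) = a i') (j : ℕ) :
    lowerTerm a j ≤ (lowerTerm a j).comap f := by
  choose σ hσ using hf
  refine Subgroup.normalClosure_le_normal ?_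
  rintro x ⟨l, hl, rfl⟩
  refine Subgroup.subset_normalClosure ⟨l.map σ, by simp [hl], ?_⟩
  rw [map_leftCommutator, List.map_map, List.map_map]
  exact congrArg leftCommutator (List.map_congr_left fun i _ => hσ i)

theorem mk_leftCommutator_mem_center (ha : Subgroup.closure (Set.range a) = ⊤) {l : List ι} {j : ℕ}
    (hl : l.length = j + 1) :
    (QuotientGroup.mk' (lowerTerm a (j + 1)) (leftCommutator (l.map a))) ∈
      Subgroup.center (Γ ⧸ lowerTerm a (j + 1)) := by
  set u := leftCommutator (l.map a) with hu
  have h1 : (⊤ : Subgroup Γ) ≤ (Subgroup.centralizer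
      {QuotientGroup.mk' (lowerTerm a (j + 1)) u}).comap (QuotientGroup.mk' _) := by
    rw [← ha, Subgroup.closure_le]
    rintro _ ⟨i, rfl⟩
    rw [SetLike.mem_coe, Subgroup.mem_comap, Subgroup.mem_centralizer_singleton_iff]
    refine (commutatorElement_eq_one_iff_mul_comm.1 ?_).symm
    have hne : l.map a ≠ [] := by
      intro h
      have := congrArg List.length h
      simp [hl] at this
    rw [← map_commutatorElement, hu, ← leftCommutator_concat hne, ← List.map_singleton,
      ← List.map_append]
    exact (QuotientGroup.eq_one_iff _).2 (leftCommutator_mem_lowerTerm (by simp [hl]))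
  rw [Subgroup.mem_center_iff]
  intro g
  obtain ⟨y, rfl⟩ := QuotientGroup.mk'_surjective _ g
  exact Subgroup.mem_centralizer_singleton_iff.1 (h1 (Subgroup.mem_top y))

theorem map_lowerTerm_le_center (ha : Subgroup.closure (Set.range a) = ⊤) (j : ℕ) :
    lowerTerm a j ≤ (Subgroup.center (Γ ⧸ lowerTerm a (j + 1))).comap (QuotientGroup.mk' _) := by
  refine Subgroup.normalClosure_le_normal ?_
  rintro x ⟨l, hl, rfl⟩
  exact mk_leftCommutator_mem_center ha hl

theorem commutator_mem_lowerTerm (ha : Subgroup.closure (Set.range a) = ⊤) {j : ℕ} {x : Γ}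
    (hx : x ∈ lowerTerm a j) (y : Γ) : ⁅x, y⁆ ∈ lowerTerm a (j + 1) := by
  rw [← QuotientGroup.eq_one_iff]
  change QuotientGroup.mk' (lowerTerm a (j + 1)) ⁅x, y⁆ = 1
  rw [map_commutatorElement, commutatorElement_eq_one_iff_mul_comm]
  exact (Subgroup.mem_center_iff.1 (map_lowerTerm_le_center ha j hx) _).symm

theorem commutator_pow_eq_one {x y : Γ} {q : ℕ} (h : ⁅x, y⁆ ∈ Subgroup.center Γ)
    (hy : y ^ q = 1) : ⁅x, y⁆ ^ q = 1 := by
  have h1 : Commute ⁅x, y⁆ y := (Subgroup.mem_center_iff.1 h y).symm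
  have h2 : x * y * x⁻¹ = ⁅x, y⁆ * y := by
    rw [commutatorElement_def, inv_mul_cancel_right]
  have h3 : (x * y * x⁻¹) ^ q = 1 := by
    rw [conj_pow, hy, mul_one, mul_inv_cancel]
  rwa [h2, h1.mul_pow, hy, mul_one] at h3

theorem pow_mem_lowerTerm (ha : Subgroup.closure (Set.range a) = ⊤) {q : ℕ}
    (haq : ∀ i, a i ^ q = 1) {j : ℕ} {x : Γ} (hx : x ∈ lowerTerm a j) :
    x ^ q ∈ lowerTerm a (j + 1) := by
  set Q := Γ ⧸ lowerTerm a (j + 1) with hQ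
  -- the elements of exponent `q` in the centre form a normal subgroup
  let P : Subgroup Q :=
    { carrier := {z | z ∈ Subgroup.center Q ∧ z ^ q = 1}
      one_mem' := ⟨Subgroup.one_mem _, one_pow q⟩
      mul_mem' := fun {y z} hy hz => ⟨Subgroup.mul_mem _ hy.1 hz.1, by
        rw [Commute.mul_pow ((Subgroup.mem_center_iff.1 hz.1 y)), hy.2, hz.2, one_mul]⟩
      inv_mem' := fun {y} hy => ⟨Subgroup.inv_mem _ hy.1, by rw [inv_pow, hy.2, inv_one]⟩ }
  have hP : P.Normal := by
    refine ⟨fun z hz g => ?_⟩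
    rwa [Subgroup.mem_center_iff.1 hz.1 g, mul_inv_cancel_right]
  have hle : lowerTerm a j ≤ P.comap (QuotientGroup.mk' _) := by
    refine Subgroup.normalClosure_le_normal ?_
    rintro x ⟨l, hl, rfl⟩
    have hc := mk_leftCommutator_mem_center ha hl
    refine ⟨hc, ?_⟩
    rcases j with _ | j
    · obtain ⟨i, rfl⟩ := List.length_eq_one_iff.1 hl
      rw [← map_pow]
      change QuotientGroup.mk' _ (a i ^ q) = 1
      rw [haq, map_one]
    · obtain ⟨l', i, -, h⟩ := exists_leftCommutator_eq (a := a) hl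
      rw [h, map_commutatorElement] at hc ⊢
      exact commutator_pow_eq_one hc (by rw [← map_pow, haq, map_one])
  rw [← QuotientGroup.eq_one_iff]
  exact (hle hx).2

end LeftNormed

/-! ### Property `H_T` for bounded `κ` -/

section PropertyHT

open scoped commutatorElement

variable {q : ℕ} {κ : ℕ → ℕ}

theorem gen_pow (q : ℕ) (i : ℤ) : gen q i ^ q = 1 := by
  rw [gen, ← map_pow, ← ofAdd_nsmul, nsmul_one, ZMod.natCast_self, ofAdd_zero, map_one]

theorem of_eq_gen_pow [NeZero q] (i : ℤ) (x : Multiplicative (ZMod q)) :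
    Monoid.CoprodI.of (M := fun _ : ℤ => Multiplicative (ZMod q)) (i := i) x =
      gen q i ^ (x.toAdd.val) := by
  rw [gen, ← map_pow, ← ofAdd_nsmul, nsmul_one, ZMod.natCast_zmod_val, ofAdd_toAdd]

theorem closure_range_gen (q : ℕ) [NeZero q] : Subgroup.closure (Set.range (gen q)) = ⊤ := by
  rw [eq_top_iff]
  intro x _
  induction x using Monoid.CoprodI.induction_on with
  | one => exact Subgroup.one_mem _
  | of i m =>
    rw [of_eq_gen_pow]
    exact Subgroup.pow_mem _ (Subgroup.subset_closure (Set.mem_range_self i)) _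
  | mul x y hx hy => exact Subgroup.mul_mem _ (hx trivial) (hy trivial)

/-- The image of `a_i` in `N(k)`. -/
def genN (q : ℕ) (k : Finset ℤ → ℕ) (i : ℤ) : N q k := QuotientGroup.mk' _ (gen q i)

theorem closure_range_genN (q : ℕ) [NeZero q] (k : Finset ℤ → ℕ) :
    Subgroup.closure (Set.range (genN q k)) = ⊤ := by
  have h : Set.range (genN q k) = QuotientGroup.mk' _ '' Set.range (gen q) := by
    rw [← Set.range_comp]
    rfl
  rw [h, ← MonoidHom.map_closure, closure_range_gen,
    Subgroup.map_top_of_surjective _ (QuotientGroup.mk'_surjective _)]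

theorem genN_pow (q : ℕ) (k : Finset ℤ → ℕ) (i : ℤ) : genN q k i ^ q = 1 := by
  rw [genN, ← map_pow, gen_pow, map_one]

theorem shiftAction_genN (z : Multiplicative ℤ) (i : ℤ) :
    shiftAction q (kOf κ) (kOf_invariant κ) z (genN q (kOf κ) i) =
      genN q (kOf κ) (i + z.toAdd) := by
  change QuotientGroup.mk' _ (shiftFree q z.toAdd (gen q i)) = _
  rw [shiftFree_gen]
  rfl

theorem leftCommutator_genN_eq_one {K : ℕ} (hκ0 : 0 < κ 0) (hκ : Monotone κ) (hK : ∀ n, κ n ≤ K)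
    {l : List ℤ} (hl : l.length = K) : leftCommutator (l.map (genN q (kOf κ))) = 1 := by
  set Y : Finset ℤ := l.toFinset with hY
  have hpos : 0 < kOf κ Y := hκ0.trans_le (hκ (Nat.zero_le _))
  have hle : kOf κ Y ≤ l.length := hl ▸ hK _
  have hlen : (l.take (kOf κ Y)).length = kOf κ Y := by simp [hle]
  have hne : (l.take (kOf κ Y)).map (genN q (kOf κ)) ≠ [] := by
    intro h
    have := congrArg List.length h
    rw [List.length_map, hlen] at this
    exact hpos.ne' this
  rw [← List.take_append_drop (kOf κ Y) l, List.map_append]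
  refine leftCommutator_append_eq_one hne ?_ _
  have h1 : genN q (kOf κ) = QuotientGroup.mk' _ ∘ gen q := rfl
  rw [h1, ← List.map_map, ← map_leftCommutator]
  refine (QuotientGroup.eq_one_iff _).2 (Subgroup.subset_normalClosure ⟨Y, _, hlen, ?_, rfl⟩)
  exact fun i hi => List.mem_toFinset.2 (List.mem_of_mem_take hi)

theorem inl_genN_eq (i : ℤ) :
    (SemidirectProduct.inl (genN q (kOf κ) i) : GromovGroup q κ) =
      SemidirectProduct.inr (Multiplicative.ofAdd i) * SemidirectProduct.inl (genN q (kOf κ) 0) *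
        (SemidirectProduct.inr (Multiplicative.ofAdd i))⁻¹ := by
  rw [← map_inv, ← SemidirectProduct.inl_aut, shiftAction_genN, toAdd_ofAdd, zero_add]

variable (q κ) in
/-- The group `G(q, κ)` is generated by `a_0` and the translation by `1`. -/
theorem closure_generators [NeZero q] :
    Subgroup.closure {(SemidirectProduct.inl (genN q (kOf κ) 0) : GromovGroup q κ),
      SemidirectProduct.inr (Multiplicative.ofAdd 1)} = ⊤ := by
  set C := Subgroup.closure {(SemidirectProduct.inl (genN q (kOf κ) 0) : GromovGroup q κ),
    SemidirectProduct.inr (Multiplicative.ofAdd 1)} with hC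
  have ha : (SemidirectProduct.inl (genN q (kOf κ) 0) : GromovGroup q κ) ∈ C :=
    Subgroup.subset_closure (by simp)
  have ht : (SemidirectProduct.inr (Multiplicative.ofAdd 1) : GromovGroup q κ) ∈ C :=
    Subgroup.subset_closure (by simp)
  have hr : ∀ z : Multiplicative ℤ, (SemidirectProduct.inr z : GromovGroup q κ) ∈ C := by
    intro z
    have h1 : z = Multiplicative.ofAdd (1 : ℤ) ^ z.toAdd := by
      rw [← ofAdd_zsmul, smul_eq_mul, mul_one, ofAdd_toAdd]
    rw [h1, map_zpow]
    exact Subgroup.zpow_mem _ ht _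
  have hl : ∀ x, (SemidirectProduct.inl x : GromovGroup q κ) ∈ C := by
    have h1 : (⊤ : Subgroup (N q (kOf κ))) ≤ C.comap SemidirectProduct.inl := by
      rw [← closure_range_genN q (kOf κ), Subgroup.closure_le]
      rintro _ ⟨i, rfl⟩
      rw [SetLike.mem_coe, Subgroup.mem_comap, inl_genN_eq]
      exact Subgroup.mul_mem _ (Subgroup.mul_mem _ (hr _) ha) (Subgroup.inv_mem _ (hr _))
    exact fun x => h1 (Subgroup.mem_top x)
  rw [eq_top_iff]
  intro g _
  rw [← SemidirectProduct.inl_left_mul_inr_right g]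
  exact Subgroup.mul_mem _ (hl _) (hr _)

theorem normal_map_inl_lowerTerm (j : ℕ) :
    ((lowerTerm (genN q (kOf κ)) j).map
      (SemidirectProduct.inl : N q (kOf κ) →* GromovGroup q κ)).Normal := by
  refine ⟨?_⟩
  rintro _ ⟨x, hx, rfl⟩ g
  refine ⟨g.left * shiftAction q (kOf κ) (kOf_invariant κ) g.right x * g.left⁻¹, ?_, ?_⟩
  · refine (inferInstance : (lowerTerm (genN q (kOf κ)) j).Normal).conj_mem _ ?_ _
    exact map_lowerTerm_le (f := (shiftAction q (kOf κ) (kOf_invariant κ) g.right).toMonoidHom)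
      (fun i => ⟨_, shiftAction_genN g.right i⟩) j hx
  · have hg := SemidirectProduct.inl_left_mul_inr_right g
    calc _ = (SemidirectProduct.inl g.left * SemidirectProduct.inr g.right) *
          SemidirectProduct.inl x * (SemidirectProduct.inl g.left * SemidirectProduct.inr g.right)⁻¹ := by
            rw [map_mul, map_mul, SemidirectProduct.inl_aut, mul_inv_rev, map_inv, map_inv]
            simp only [mul_assoc]
      _ = _ := by rw [hg]

/-- If `κ` is bounded then `N` is nilpotent, and its lower central series has factors of
exponent `q`. -/
theorem hasPropertyHT_of_bddAbove.{w} [NeZero q] (hκ : Monotone κ) (hκ0 : 0 < κ 0)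
    (hbdd : BddAbove (Set.range κ)) : HasPropertyHT.{0, w} (GromovGroup q κ) := by
  intro H _ _ _ π hπ
  refine ⟨UnitaryRep.invariants π ⊤, fun hinv => ?_, fun g w hw => hw (Subgroup.mem_top g)⟩
  obtain ⟨K, hK⟩ := hbdd
  have hK' : ∀ n, κ n ≤ K := fun n => hK ⟨n, rfl⟩
  have hKpos : 0 < K := hκ0.trans_le (hK' 0)
  have ha := closure_range_genN q (kOf κ)
  refine UnitaryRep.not_nontrivial_of_vanishes (UnitaryRep.vanishes_of_central_series
    (t := SemidirectProduct.inr (Multiplicative.ofAdd 1)) (k := K - 1) (NeZero.pos q)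
    (fun j => (lowerTerm (genN q (kOf κ)) j).map SemidirectProduct.inl)
    normal_map_inl_lowerTerm (fun i j hij => Subgroup.map_mono (lowerTerm_antitone hij)) ?_ ?_ ?_
    (Set.toFinite {(SemidirectProduct.inl (genN q (kOf κ) 0) : GromovGroup q κ),
      SemidirectProduct.inr (Multiplicative.ofAdd 1)}) ?_ (closure_generators q κ) hinv) hπ
  · rw [lowerTerm_eq_bot, Subgroup.map_bot]
    exact fun l hl => leftCommutator_genN_eq_one hκ0 hκ hK' (by omega)
  · rintro j _ ⟨x, hx, rfl⟩ _ ⟨y, -, rfl⟩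
    rw [← map_commutatorElement]
    exact Subgroup.mem_map_of_mem _ (commutator_mem_lowerTerm ha hx y)
  · rintro j _ ⟨x, hx, rfl⟩
    rw [← map_pow]
    exact Subgroup.mem_map_of_mem _ (pow_mem_lowerTerm ha (genN_pow q _) hx)
  · rintro _ (rfl | rfl)
    · exact Or.inl (Subgroup.mem_map_of_mem _ (by rw [lowerTerm_zero ha]; trivial))
    · exact Or.inr rfl

end PropertyHT

end Gromov

/-! ### Products in a ring that vanish for reasons of length -/

section Words

variable {E : Type*} [Ring E]

theorem sub_one_pow_char {q : ℕ} [Fact q.Prime] [CharP E q] {R : E} (hR : R ^ q = 1) :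
    (R - 1) ^ q = 0 := by
  rw [sub_pow_char_of_commute q (Commute.one_right R), one_pow, hR, sub_self]

theorem mul_sub_one_pow_mul {R τ τ' : E} {q : ℕ}
    (h : ∀ c, 0 < c → c < q → τ' * R ^ c * τ = 0) {j : ℕ} (hj : j < q) :
    τ' * (R - 1) ^ j * τ = (-1 : ℤ) ^ j • (τ' * τ) := by
  rw [sub_eq_add_neg, (Commute.neg_right (Commute.one_right R)).add_pow, Finset.mul_sum,
    Finset.sum_mul, Finset.sum_eq_single 0]
  · rcases Nat.even_or_odd j with hj' | hj' <;> simp [hj'.neg_one_pow]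
  · intro c hc hc0
    have h1 := h c (Nat.pos_of_ne_zero hc0) (by
      rw [Finset.mem_range] at hc
      omega)
    have h2 : ((-1 : E) ^ (j - c) * (j.choose c : E)) * τ =
        τ * ((-1 : E) ^ (j - c) * (j.choose c : E)) :=
      (((Commute.neg_one_left τ).pow_left _).mul_left (Nat.cast_commute _ _)).eq
    calc τ' * (R ^ c * (-1) ^ (j - c) * (j.choose c : E)) * τ
        = τ' * R ^ c * (((-1 : E) ^ (j - c) * (j.choose c : E)) * τ) := by
          simp only [mul_assoc]
      _ = τ' * R ^ c * τ * ((-1 : E) ^ (j - c) * (j.choose c : E)) := by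
          rw [h2]
          simp only [mul_assoc]
      _ = 0 := by rw [h1, zero_mul]
  · simp

/-- Let `R - 1` be nilpotent of order `q`, and let the elements of `T` be such that
`τ' R ^ c τ = 0` for `0 < c < q`. If all products of `d` elements of `T` vanish, then so do all
products of `q d` elements of `T ∪ {R - 1}`. Indeed `τ' (R - 1) ^ j τ = ± τ' τ`, so that a non-zero
product of length `q d` would shrink to a product of at least `d` elements of `T`. -/
theorem list_prod_insert_eq_zero {R : E} {T : Set E} {q d : ℕ} (hR : (R - 1) ^ q = 0)
    (hT : ∀ τ ∈ T, ∀ τ' ∈ T, ∀ c, 0 < c → c < q → τ' * R ^ c * τ = 0)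
    (hd : ∀ l : List E, (∀ x ∈ l, x ∈ T) → d ≤ l.length → l.prod = 0) (l : List E)
    (hl : ∀ x ∈ l, x ∈ insert (R - 1) T) (hlen : q * d ≤ l.length) : l.prod = 0 := by
  have hq : 0 < q ∨ q = 0 := Nat.eq_zero_or_pos q |>.symm
  rcases hq with hq | rfl
  swap
  · rw [pow_zero] at hR
    rw [← mul_one l.prod, hR, mul_zero]
  have key : ∀ l : List E, (∀ x ∈ l, x ∈ insert (R - 1) T) → l.prod = 0 ∨
      ∃ (e : ℤ) (j k : ℕ) (l' : List E), j < q ∧ k < q ∧ (∀ x ∈ l', x ∈ T) ∧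
        l.prod = e • ((R - 1) ^ j * l'.prod * (R - 1) ^ k) ∧
        ((l' = [] ∧ k = 0 ∧ l.length ≤ j) ∨
          (l' ≠ [] ∧ l.length + q ≤ q * l'.length + 1 + j + k)) := by
    intro l
    induction l with
    | nil => exact fun _ => Or.inr ⟨1, 0, 0, [], hq, hq, by simp, by simp, Or.inl (by simp)⟩
    | cons x l ih =>
      intro hl
      rcases ih fun y hy => hl y (List.mem_cons_of_mem _ hy) with h0 |
        ⟨e, j, k, l', hj, hk, hl', hprod, hcase⟩
      · exact Or.inl (by rw [List.prod_cons, h0, mul_zero])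
      rcases hl x List.mem_cons_self with rfl | hx
      · rcases Nat.lt_or_ge (j + 1) q with hj' | hj'
        · refine Or.inr ⟨e, j + 1, k, l', hj', hk, hl', ?_, ?_⟩
          · rw [List.prod_cons, hprod, mul_smul_comm, pow_succ' _ j]
            simp only [mul_assoc]
          · rw [List.length_cons]
            rcases hcase with ⟨h1, h2, h3⟩ | ⟨h1, h2⟩
            · exact Or.inl ⟨h1, h2, by omega⟩
            · exact Or.inr ⟨h1, by omega⟩
        · left
          have hjq : q = j + 1 := by omega
          rw [List.prod_cons, hprod, mul_smul_comm, mul_assoc ((R - 1) ^ j), ← mul_assoc,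
            ← pow_succ', ← hjq, hR, zero_mul, smul_zero]
      · right
        rcases hcase with ⟨rfl, rfl, h3⟩ | ⟨h1, h2⟩
        · refine ⟨e, 0, j, [x], hq, hj, by simpa using hx, ?_, Or.inr ⟨by simp, ?_⟩⟩
          · rw [List.prod_cons, hprod, mul_smul_comm]
            simp
          · simp only [List.length_cons, List.length_nil]
            omega
        · obtain ⟨y, l'', rfl⟩ := List.exists_cons_of_ne_nil h1
          refine ⟨e * (-1) ^ j, 0, k, x :: y :: l'', hq, hk, ?_, ?_, Or.inr ⟨by simp, ?_⟩⟩
          · intro z hz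
            rcases List.mem_cons.1 hz with rfl | hz
            · exact hx
            · exact hl' z hz
          · have h3 := mul_sub_one_pow_mul (hT y (hl' y List.mem_cons_self) x hx) hj
            rw [List.prod_cons, hprod, List.prod_cons, List.prod_cons, List.prod_cons, pow_zero,
              one_mul, mul_smul, mul_smul_comm]
            congr 1
            calc x * ((R - 1) ^ j * (y * l''.prod) * (R - 1) ^ k)
                = (x * (R - 1) ^ j * y) * l''.prod * (R - 1) ^ k := by simp only [mul_assoc]
              _ = _ := by
                rw [h3]
                simp only [smul_mul_assoc, mul_assoc]
          · simp only [List.length_cons, mul_add] at h2 ⊢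
            omega
  rcases key l hl with h0 | ⟨e, j, k, l', hj, hk, hl', hprod, hcase⟩
  · exact h0
  have hdl : d ≤ l'.length := by
    rcases hcase with ⟨rfl, -, h3⟩ | ⟨-, h2⟩
    · have h4 : q * d < q * 1 := by omega
      have := Nat.lt_of_mul_lt_mul_left h4
      simp only [List.length_nil]
      omega
    · have h4 : q * d < q * (l'.length + 1) := by
        rw [mul_add]
        omega
      have := Nat.lt_of_mul_lt_mul_left h4
      omega
  rw [hprod, hd l' hl' hdl, mul_zero, zero_mul, smul_zero]

/-- The additive group spanned by the products of at least `k` elements of `T`. -/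
def wordSpan (T : Set E) (k : ℕ) : Submodule ℤ E :=
  Submodule.span ℤ {x | ∃ l : List E, (∀ y ∈ l, y ∈ T) ∧ k ≤ l.length ∧ x = l.prod}

variable {T : Set E}

theorem wordSpan_anti {k m : ℕ} (h : k ≤ m) : wordSpan T m ≤ wordSpan T k :=
  Submodule.span_mono fun _ ⟨l, hl, hm, hx⟩ => ⟨l, hl, h.trans hm, hx⟩

theorem one_mem_wordSpan : (1 : E) ∈ wordSpan T 0 :=
  Submodule.subset_span ⟨[], by simp, by simp, by simp⟩

theorem mem_wordSpan_one {x : E} (hx : x ∈ T) : x ∈ wordSpan T 1 :=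
  Submodule.subset_span ⟨[x], by simpa using hx, by simp, by simp⟩

theorem mul_mem_wordSpan {k m : ℕ} {x y : E} (hx : x ∈ wordSpan T k) (hy : y ∈ wordSpan T m) :
    x * y ∈ wordSpan T (k + m) := by
  have h := Submodule.mul_mem_mul hx hy
  rw [wordSpan, wordSpan, Submodule.span_mul_span] at h
  refine Submodule.span_mono ?_ h
  rintro _ ⟨_, ⟨l, hl, hk, rfl⟩, _, ⟨l', hl', hm, rfl⟩, rfl⟩
  refine ⟨l ++ l', fun z hz => ?_, ?_, by simp⟩
  · exact (List.mem_append.1 hz).elim (hl z) (hl' z)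
  · rw [List.length_append]
    omega

theorem mul_mem_wordSpan_left {k : ℕ} {x y : E} (hx : x ∈ wordSpan T 0) (hy : y ∈ wordSpan T k) :
    x * y ∈ wordSpan T k := by
  have h := mul_mem_wordSpan hx hy
  rwa [zero_add] at h

theorem mul_mem_wordSpan_right {k : ℕ} {x y : E} (hx : x ∈ wordSpan T k)
    (hy : y ∈ wordSpan T 0) : x * y ∈ wordSpan T k := by
  have h := mul_mem_wordSpan hx hy
  rwa [add_zero] at h

variable {Γ : Type*} [Group Γ] {ρ : Γ →* E}

/-- `g - 1` and `g⁻¹ - 1` are combinations of products of at least `k` elements of `T`. -/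
def IsDeep (ρ : Γ →* E) (T : Set E) (k : ℕ) (g : Γ) : Prop :=
  ρ g - 1 ∈ wordSpan T k ∧ ρ g⁻¹ - 1 ∈ wordSpan T k

theorem IsDeep.inv {k : ℕ} {g : Γ} (h : IsDeep ρ T k g) : IsDeep ρ T k g⁻¹ :=
  ⟨h.2, by simpa using h.1⟩

theorem IsDeep.mem_wordSpan_zero {k : ℕ} {g : Γ} (h : IsDeep ρ T k g) : ρ g ∈ wordSpan T 0 := by
  have := Submodule.add_mem _ (wordSpan_anti (Nat.zero_le k) h.1) one_mem_wordSpan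
  rwa [sub_add_cancel] at this

open scoped commutatorElement

theorem sub_one_mem_of_isDeep {k m : ℕ} {x y : Γ} (hx : IsDeep ρ T k x) (hy : IsDeep ρ T m y) :
    ρ ⁅x, y⁆ - 1 ∈ wordSpan T (k + m) := by
  have h1 : ρ ⁅x, y⁆ - 1 =
      ((ρ x - 1) * (ρ y - 1) - (ρ y - 1) * (ρ x - 1)) * (ρ x⁻¹ * ρ y⁻¹) := by
    have h2 : (ρ x - 1) * (ρ y - 1) - (ρ y - 1) * (ρ x - 1) = ρ (x * y) - ρ (y * x) := by
      rw [map_mul, map_mul]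
      noncomm_ring
    rw [h2, ← map_mul, sub_mul, ← map_mul, ← map_mul, commutatorElement_def]
    have h3 : y * x * (x⁻¹ * y⁻¹) = 1 := by group
    rw [h3, map_one, mul_assoc (x * y)]
  rw [h1]
  have h2 : (ρ y - 1) * (ρ x - 1) ∈ wordSpan T (k + m) :=
    add_comm m k ▸ mul_mem_wordSpan hy.1 hx.1
  exact mul_mem_wordSpan_right (Submodule.sub_mem _ (mul_mem_wordSpan hx.1 hy.1) h2)
    (mul_mem_wordSpan_left hx.inv.mem_wordSpan_zero hy.inv.mem_wordSpan_zero)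

theorem IsDeep.commutator {k m : ℕ} {x y : Γ} (hx : IsDeep ρ T k x) (hy : IsDeep ρ T m y) :
    IsDeep ρ T (k + m) ⁅x, y⁆ := by
  refine ⟨sub_one_mem_of_isDeep hx hy, ?_⟩
  rw [commutatorElement_inv, add_comm]
  exact sub_one_mem_of_isDeep hy hx

theorem isDeep_of_pow_eq_one {g : Γ} {q : ℕ} (hq : 0 < q) (hg : g ^ q = 1) (h : ρ g - 1 ∈ T) :
    IsDeep ρ T 1 g := by
  have h1 := mem_wordSpan_one h
  refine ⟨h1, ?_⟩
  have h2 : ρ g ∈ wordSpan T 0 := by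
    have := Submodule.add_mem _ (wordSpan_anti (Nat.zero_le 1) h1) one_mem_wordSpan
    rwa [sub_add_cancel] at this
  have h3 : ∀ n : ℕ, ρ (g ^ n) ∈ wordSpan T 0 := by
    intro n
    induction n with
    | zero => simpa using one_mem_wordSpan
    | succ n ih =>
      rw [pow_succ, map_mul]
      exact mul_mem_wordSpan_left ih h2
  have h4 : g⁻¹ = g ^ (q - 1) := by
    rw [inv_eq_iff_mul_eq_one, ← pow_succ', Nat.sub_add_cancel hq, hg]
  have h5 : ρ g⁻¹ - 1 = -(ρ g⁻¹ * (ρ g - 1)) := by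
    rw [mul_sub, ← map_mul, inv_mul_cancel, map_one, mul_one, neg_sub]
  rw [h5]
  refine Submodule.neg_mem _ (mul_mem_wordSpan_left ?_ h1)
  rw [h4]
  exact h3 _

theorem isDeep_leftCommutator {l : List Γ} (hl : ∀ g ∈ l, IsDeep ρ T 1 g) (hne : l ≠ []) :
    IsDeep ρ T l.length (Gromov.leftCommutator l) := by
  induction l using List.reverseRecOn with
  | nil => exact absurd rfl hne
  | append_singleton l g ih =>
    rcases eq_or_ne l [] with rfl | hne'
    · exact hl g (by simp)
    · rw [Gromov.leftCommutator_concat hne', List.length_append]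
      exact (ih (fun x hx => hl x (by simp [hx])) hne').commutator (hl g (by simp))

theorem leftCommutator_eq_one_of_words {d : ℕ} (hρ : ∀ g, ρ g = 1 → g = 1)
    (hd : ∀ l : List E, (∀ x ∈ l, x ∈ T) → d ≤ l.length → l.prod = 0) {l : List Γ}
    (hl : ∀ g ∈ l, IsDeep ρ T 1 g) (hne : l ≠ []) (hlen : d ≤ l.length) :
    Gromov.leftCommutator l = 1 := by
  have h1 : wordSpan T l.length ≤ ⊥ := Submodule.span_le.2 (by
    rintro _ ⟨l', hl', hk, rfl⟩
    exact hd l' hl' (hlen.trans hk))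
  exact hρ _ (sub_eq_zero.1 ((Submodule.mem_bot ℤ).1 (h1 (isDeep_leftCommutator hl hne).1)))

end Words

namespace DiscreteAffine

/-! ### Rotations of the tree and the quotient map onto the discrete affine group -/

section Rotations

variable {q : ℕ}

theorem level_translate (z : ℤ) (v : Vertex q) : (translate z v).level = v.level + z := rfl

theorem translate_translate (y z : ℤ) (v : Vertex q) :
    translate y (translate z v) = translate (z + y) v :=
  Vertex.ext' (by simp only [level_translate]; ring) fun i => by
    simp only [translate_label]
    congr 1
    ring

theorem translate_zero (v : Vertex q) : translate 0 v = v :=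
  Vertex.ext' (by simp [level_translate]) fun i => by simp [translate_label]

theorem shift_zpow_apply (z : ℤ) (v : Vertex q) : (shift q ^ z) v = translate z v := by
  induction z using Int.induction_on generalizing v with
  | zero => rw [zpow_zero, translate_zero]; rfl
  | succ n ih =>
    rw [zpow_add_one, RelIso.mul_apply, ih]
    change translate n (translate 1 v) = _
    rw [translate_translate, add_comm]
  | pred n ih =>
    rw [zpow_sub_one, RelIso.mul_apply, ih]
    change translate (-n) (translate (-1) v) = _
    rw [translate_translate]
    congr 1
    ring

theorem rotate_apply (c : ZMod q) (v : Vertex q) : rotate q c v = rotateFun c v := rfl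

theorem rotate_add (c d : ZMod q) : rotate q (c + d) = rotate q c * rotate q d := by
  ext v
  rw [RelIso.mul_apply, rotate_apply, rotate_apply, rotate_apply]
  refine Vertex.ext' rfl fun i => ?_
  rw [rotateFun_label, rotateFun_label, rotateFun_label, below_rotateFun]
  split_ifs
  · ring
  · simp

/-- The rotations at the vertex `o`, as a homomorphism. -/
noncomputable def rotateHom (q : ℕ) : Multiplicative (ZMod q) →* (tree q ≃g tree q) :=
  MonoidHom.mk' (fun c => rotate q c.toAdd) fun c d => rotate_add c.toAdd d.toAdd

/-- The rotations at the vertex of level `i` with zero labels, the translate of `o`. -/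
noncomputable def rotateAt (q : ℕ) (i : ℤ) : Multiplicative (ZMod q) →* (tree q ≃g tree q) :=
  (MulAut.conj (shift q ^ i)).toMonoidHom.comp (rotateHom q)

theorem rotateAt_eq (i : ℤ) (c : Multiplicative (ZMod q)) :
    rotateAt q i c = shift q ^ i * rotate q c.toAdd * (shift q ^ i)⁻¹ := rfl

/-- `v` lies strictly below the vertex of level `i` with zero labels. -/
def BelowAt (i : ℤ) (v : Vertex q) : Prop := v.level < i ∧ ∀ j, i ≤ j → v.label j = 0

theorem below_translate_neg (i : ℤ) (v : Vertex q) : Below (translate (-i) v) ↔ BelowAt i v := by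
  unfold Below BelowAt
  rw [level_translate]
  refine and_congr ⟨fun h => by omega, fun h => by omega⟩ ?_
  constructor
  · intro h j hj
    have := h (j - i) (by omega)
    rwa [translate_label, sub_neg_eq_add, sub_add_cancel] at this
  · intro h j hj
    rw [translate_label]
    exact h _ (by omega)

theorem rotateAt_apply (i : ℤ) (c : Multiplicative (ZMod q)) (v : Vertex q) :
    rotateAt q i c v = translate i (rotateFun c.toAdd (translate (-i) v)) := by
  rw [rotateAt_eq, ← zpow_neg, RelIso.mul_apply, RelIso.mul_apply, shift_zpow_apply,
    shift_zpow_apply, rotate_apply]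

theorem level_rotateAt (i : ℤ) (c : Multiplicative (ZMod q)) (v : Vertex q) :
    (rotateAt q i c v).level = v.level := by
  rw [rotateAt_apply, level_translate]
  change (translate (-i) v).level + i = _
  rw [level_translate]
  ring

open Classical in
theorem label_rotateAt (i : ℤ) (c : Multiplicative (ZMod q)) (v : Vertex q) (k : ℤ) :
    (rotateAt q i c v).label k =
      v.label k + if BelowAt i v ∧ k = i - 1 then c.toAdd else 0 := by
  rw [rotateAt_apply, translate_label, rotateFun_label, translate_label]
  have h1 : k - i - -i = k := by ring
  have h2 : k - i = -1 ↔ k = i - 1 := by omega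
  simp only [h1, h2, below_translate_neg]

theorem rotateAt_of_not_belowAt {i : ℤ} {v : Vertex q} (h : ¬ BelowAt i v)
    (c : Multiplicative (ZMod q)) : rotateAt q i c v = v := by
  classical
  refine Vertex.ext' (level_rotateAt i c v) fun k => ?_
  rw [label_rotateAt, if_neg (fun h' => h h'.1), add_zero]

theorem belowAt_rotateAt {i : ℤ} {v : Vertex q} (h : BelowAt i v) (c : Multiplicative (ZMod q)) :
    BelowAt i (rotateAt q i c v) := by
  classical
  refine ⟨(level_rotateAt i c v).trans_lt h.1, fun j hj => ?_⟩
  rw [label_rotateAt, if_neg (fun h' => by omega), add_zero, h.2 j hj]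

theorem BelowAt.mono {i n : ℤ} (hin : i ≤ n) {v : Vertex q} (h : BelowAt i v) : BelowAt n v :=
  ⟨h.1.trans_le hin, fun j hj => h.2 j (hin.trans hj)⟩

variable (q) in
/-- The permutation representation of the automorphism group of the tree over `ℤ/q`. -/
noncomputable def permRep :
    (tree q ≃g tree q) →* Module.End (ZMod q) (Vertex q →₀ ZMod q) where
  toFun g := Finsupp.lmapDomain (ZMod q) (ZMod q) g
  map_one' := Finsupp.lmapDomain_id (ZMod q) (ZMod q)
  map_mul' g h := Finsupp.lmapDomain_comp (ZMod q) (ZMod q) h g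

theorem permRep_single (g : tree q ≃g tree q) (v : Vertex q) (c : ZMod q) :
    permRep q g (Finsupp.single v c) = Finsupp.single (g v) c := Finsupp.mapDomain_single

theorem permRep_faithful [Fact q.Prime] {g : tree q ≃g tree q} (h : permRep q g = 1) : g = 1 := by
  ext v
  have h1 := permRep_single g v 1
  rw [h] at h1
  exact ((Finsupp.single_left_inj one_ne_zero).1 h1).symm

/-- The difference operator `r_i - 1` of the rotation by `1` at level `i`. -/
noncomputable def diffOp (q : ℕ) (i : ℤ) : Module.End (ZMod q) (Vertex q →₀ ZMod q) :=
  permRep q (rotateAt q i (Multiplicative.ofAdd 1)) - 1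

theorem diffOp_single_of_not_belowAt {i : ℤ} {v : Vertex q} (h : ¬ BelowAt i v) (c : ZMod q) :
    diffOp q i (Finsupp.single v c) = 0 := by
  rw [diffOp, LinearMap.sub_apply, permRep_single, rotateAt_of_not_belowAt h]
  exact sub_self _

theorem rotateAt_pow (i : ℤ) : rotateAt q i (Multiplicative.ofAdd 1) ^ q = 1 := by
  rw [← map_pow, ← ofAdd_nsmul, nsmul_one, ZMod.natCast_self, ofAdd_zero, map_one]

theorem diffOp_pow [Fact q.Prime] (i : ℤ) : diffOp q i ^ q = 0 := by
  have : Nonempty (Vertex q) := ⟨⟨0, 0, fun _ _ => rfl⟩⟩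
  have : Nontrivial (Module.End (ZMod q) (Vertex q →₀ ZMod q)) := inferInstance
  have : CharP (Module.End (ZMod q) (Vertex q →₀ ZMod q)) q :=
    charP_of_injective_algebraMap (algebraMap (ZMod q) _).injective q
  have h : permRep q (rotateAt q i (Multiplicative.ofAdd 1)) ^ q = 1 := by
    rw [← map_pow, rotateAt_pow, map_one]
  exact sub_one_pow_char (E := Module.End (ZMod q) (Vertex q →₀ ZMod q)) h

/-- A rotation at a higher vertex moves the part of the tree that is rotated at a lower vertex away
from itself. -/
theorem diffOp_mul_pow_mul_diffOp {i i' n : ℤ} (hi : i < n) (hi' : i' < n) {c : ℕ} (hc : 0 < c)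
    (hcq : c < q) :
    diffOp q i' * permRep q (rotateAt q n (Multiplicative.ofAdd 1)) ^ c * diffOp q i = 0 := by
  classical
  have hmove : ∀ v : Vertex q, BelowAt i v →
      ¬ BelowAt i' (rotateAt q n (Multiplicative.ofAdd (c : ZMod q)) v) := by
    intro v hv h
    have h1 := h.2 (n - 1) (by omega)
    rw [label_rotateAt, if_pos ⟨hv.mono hi.le, rfl⟩, hv.2 (n - 1) (by omega), zero_add,
      toAdd_ofAdd, ZMod.natCast_eq_zero_iff] at h1
    exact absurd (Nat.le_of_dvd hc h1) (by omega)
  rw [← map_pow, ← map_pow, ← ofAdd_nsmul, nsmul_one]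
  refine Finsupp.lhom_ext fun v x => ?_
  rw [Module.End.mul_apply, Module.End.mul_apply, LinearMap.zero_apply]
  by_cases hv : BelowAt i v
  · have h1 : diffOp q i (Finsupp.single v x) =
        Finsupp.single (rotateAt q i (Multiplicative.ofAdd 1) v) x - Finsupp.single v x := by
      rw [diffOp, LinearMap.sub_apply, permRep_single]
      rfl
    rw [h1, map_sub, map_sub, permRep_single, permRep_single,
      diffOp_single_of_not_belowAt (hmove _ hv),
      diffOp_single_of_not_belowAt (hmove _ (belowAt_rotateAt hv _)), sub_zero]
  · rw [diffOp_single_of_not_belowAt hv, map_zero, map_zero]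

/-- Products of `q ^ k` difference operators, with indices in an interval of length `k`, vanish. -/
theorem prod_diffOp_eq_zero [Fact q.Prime] (m : ℤ) (k : ℕ)
    (l : List (Module.End (ZMod q) (Vertex q →₀ ZMod q)))
    (hl : ∀ x ∈ l, x ∈ diffOp q '' Set.Ico m (m + k)) (hlen : q ^ k ≤ l.length) : l.prod = 0 := by
  induction k generalizing l with
  | zero =>
    rw [pow_zero] at hlen
    obtain ⟨x, l, rfl⟩ := List.exists_cons_of_length_pos hlen
    simpa using hl x List.mem_cons_self
  | succ k ih =>
    refine list_prod_insert_eq_zero (q := q) (d := q ^ k) (diffOp_pow (m + k)) ?_ ih l ?_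
      (by rwa [← pow_succ'])
    · rintro _ ⟨i, hi, rfl⟩ _ ⟨i', hi', rfl⟩ c hc hcq
      exact diffOp_mul_pow_mul_diffOp hi.2 hi'.2 hc hcq
    · intro x hx
      obtain ⟨i, hi, rfl⟩ := hl x hx
      rcases eq_or_ne i (m + k) with rfl | h
      · exact Or.inl rfl
      · refine Or.inr ⟨i, ⟨hi.1, ?_⟩, rfl⟩
        have := hi.2
        push_cast at this
        omega

/-- The rotations with indices in an interval of length `k` generate an iterated wreath product of
`k` copies of `ℤ/q`, in which the commutators of length `q ^ k` are trivial. -/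
theorem leftCommutator_rotateAt_eq_one [Fact q.Prime] (m : ℤ) (k : ℕ) (l : List ℤ)
    (hl : ∀ i ∈ l, m ≤ i ∧ i < m + k) (hlen : q ^ k ≤ l.length) :
    Gromov.leftCommutator (l.map fun i => rotateAt q i (Multiplicative.ofAdd 1)) = 1 := by
  have hq : 0 < q := (Fact.out : q.Prime).pos
  refine leftCommutator_eq_one_of_words (ρ := permRep q) (d := q ^ k)
    (T := diffOp q '' Set.Ico m (m + k)) (fun g => permRep_faithful) (prod_diffOp_eq_zero m k) ?_ ?_
    (by simpa using hlen)
  · intro g hg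
    obtain ⟨i, hi, rfl⟩ := List.mem_map.1 hg
    exact isDeep_of_pow_eq_one hq (rotateAt_pow i) ⟨i, hl i hi, rfl⟩
  · intro h
    have h1 := congrArg List.length h
    rw [List.length_map] at h1
    rw [h1] at hlen
    exact absurd hlen (not_le.2 (pow_pos hq k))

end Rotations

section QuotientMap

open Gromov
open scoped commutatorElement

variable {q : ℕ} {κ : ℕ → ℕ}

theorem le_diam {Y : Finset ℤ} {i j : ℤ} (hi : i ∈ Y) (hj : j ∈ Y) : (i - j).natAbs ≤ diam Y :=
  Finset.le_sup (f := fun p : ℤ × ℤ => (p.1 - p.2).natAbs) (Finset.mk_mem_product hi hj)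

/-- The homomorphism from the free product that maps `a_i` to the rotation at level `i`. -/
noncomputable def freeToAut (q : ℕ) : FreeProd q →* (tree q ≃g tree q) :=
  Monoid.CoprodI.lift (rotateAt q)

theorem freeToAut_gen (i : ℤ) : freeToAut q (gen q i) = rotateAt q i (Multiplicative.ofAdd 1) :=
  Monoid.CoprodI.lift_of _ _

theorem normalClosure_relators_le [Fact q.Prime] (hκ0 : κ 0 = 2)
    (hκq : ∀ n : ℕ, 1 ≤ n → q ^ (n + 1) < κ n) :
    Subgroup.normalClosure (relators q (kOf κ)) ≤ (freeToAut q).ker := by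
  refine Subgroup.normalClosure_le_normal ?_
  rintro x ⟨Y, l, hl, hY, rfl⟩
  change freeToAut q _ = 1
  rw [map_leftCommutator, List.map_map]
  have h1 : ⇑(freeToAut q) ∘ gen q = fun i => rotateAt q i (Multiplicative.ofAdd 1) :=
    funext freeToAut_gen
  rw [h1]
  rcases Nat.eq_zero_or_pos (diam Y) with h0 | hpos
  · rw [kOf, h0, hκ0] at hl
    obtain ⟨i, j, rfl⟩ := List.length_eq_two.1 hl
    have h2 := le_diam (hY i (by simp)) (hY j (by simp))
    obtain rfl : i = j := by omega
    simp [leftCommutator]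
  · have hne : Y.Nonempty := by
      rw [Finset.nonempty_iff_ne_empty]
      rintro rfl
      simp [diam] at hpos
    refine leftCommutator_rotateAt_eq_one (Y.min' hne) (diam Y + 1) l (fun i hi => ?_) ?_
    · have h2 := Y.min'_le i (hY i hi)
      have h3 := le_diam (hY i hi) (Y.min'_mem hne)
      push_cast
      omega
    · rw [hl]
      exact (hκq _ hpos).le

variable (hκ : Subgroup.normalClosure (relators q (kOf κ)) ≤ (freeToAut q).ker)

/-- The homomorphism `G(q, κ) → Aut(𝕋_q)` that maps `a_i` to the rotation at level `i` and the
translation to the shift. -/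
noncomputable def toAut : GromovGroup q κ →* (tree q ≃g tree q) :=
  SemidirectProduct.lift (QuotientGroup.lift _ (freeToAut q) hκ) (zpowersHom _ (shift q)) (by
    intro z
    refine QuotientGroup.monoidHom_ext _ (Monoid.CoprodI.ext_hom _ _ fun i =>
      MonoidHom.ext fun c => ?_)
    change freeToAut q (shiftFree q z.toAdd (Monoid.CoprodI.of c)) =
      shift q ^ z.toAdd * freeToAut q (Monoid.CoprodI.of c) * (shift q ^ z.toAdd)⁻¹
    rw [shiftFree_of, freeToAut, Monoid.CoprodI.lift_of, Monoid.CoprodI.lift_of, rotateAt_eq,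
      rotateAt_eq, add_comm i, zpow_add]
    group)

theorem toAut_inl_of (c : ZMod q) :
    toAut hκ (SemidirectProduct.inl (QuotientGroup.mk' _
      (Monoid.CoprodI.of (M := fun _ : ℤ => Multiplicative (ZMod q)) (i := 0)
        (Multiplicative.ofAdd c)))) = rotate q c := by
  rw [toAut, SemidirectProduct.lift_inl, QuotientGroup.mk'_apply, QuotientGroup.lift_mk, freeToAut,
    Monoid.CoprodI.lift_of, rotateAt_eq]
  simp

theorem toAut_inr_one : toAut hκ (SemidirectProduct.inr (Multiplicative.ofAdd 1)) = shift q := by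
  rw [toAut, SemidirectProduct.lift_inr]
  simp

theorem toAut_mem_DA [NeZero q] (g : GromovGroup q κ) : toAut hκ g ∈ DA q := by
  have h : (⊤ : Subgroup (GromovGroup q κ)) ≤ (DA q).comap (toAut hκ) := by
    rw [← closure_generators q κ, Subgroup.closure_le]
    rintro _ (rfl | rfl)
    · rw [SetLike.mem_coe, Subgroup.mem_comap]
      exact Set.mem_of_eq_of_mem (toAut_inl_of hκ 1) (Subgroup.subset_closure (Or.inr ⟨1, rfl⟩))
    · rw [SetLike.mem_coe, Subgroup.mem_comap, toAut_inr_one]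
      exact Subgroup.subset_closure (Or.inl rfl)
  exact h (Subgroup.mem_top g)

/-- The discrete affine group is the image of `G(q, κ)` in the automorphism group of the tree. -/
theorem exists_surjective_DA [NeZero q]
    (hκ : Subgroup.normalClosure (relators q (kOf κ)) ≤ (freeToAut q).ker) :
    ∃ φ : GromovGroup q κ →* DA q, Function.Surjective φ := by
  refine ⟨(toAut hκ).codRestrict (DA q) (toAut_mem_DA hκ), ?_⟩
  have h : DA q ≤ (toAut hκ).range := by
    rw [DA, Subgroup.closure_le]
    rintro _ (rfl | ⟨c, rfl⟩)
    · exact ⟨_, toAut_inr_one hκ⟩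
    · exact ⟨_, toAut_inl_of hκ c⟩
  rintro ⟨x, hx⟩
  obtain ⟨g, rfl⟩ := h hx
  exact ⟨g, rfl⟩

end QuotientMap

end DiscreteAffine

/-! ### Permutation representations on `ℓ²` -/

section PermutationRepresentation

open UnitaryRep

variable {X : Type*}

theorem Memℓp.comp_perm {f : X → ℂ} (hf : Memℓp f 2) (σ : Equiv.Perm X) :
    Memℓp (fun x => f (σ x)) 2 := by
  rw [memℓp_gen_iff (by norm_num)] at hf ⊢
  exact hf.comp_injective σ.injective

theorem memℓp_of_finite_support {f : X → ℂ} (hf : f.support.Finite) : Memℓp f 2 := by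
  rw [memℓp_gen_iff (by norm_num)]
  refine summable_of_hasFiniteSupport (hf.subset fun x hx => ?_)
  intro h
  simp [h] at hx

/-- The unitary representation of the permutation group of `X` on `ℓ²(X)`. -/
noncomputable def permUnitary (X : Type*) :
    Equiv.Perm X →* (lp (fun _ : X => ℂ) 2 ≃ₗᵢ[ℂ] lp (fun _ : X => ℂ) 2) where
  toFun σ :=
    { toFun := fun f => ⟨fun x => f (σ⁻¹ x), (lp.memℓp f).comp_perm σ⁻¹⟩
      invFun := fun f => ⟨fun x => f (σ x), (lp.memℓp f).comp_perm σ⟩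
      left_inv := fun f => lp.ext (funext fun x => congrArg f (σ.symm_apply_apply x))
      right_inv := fun f => lp.ext (funext fun x => congrArg f (σ.apply_symm_apply x))
      map_add' := fun f g => lp.ext (funext fun x => rfl)
      map_smul' := fun c f => lp.ext (funext fun x => rfl)
      norm_map' := fun f => by
        rw [lp.norm_eq_tsum_rpow (by norm_num), lp.norm_eq_tsum_rpow (by norm_num)]
        congr 1
        exact Equiv.tsum_eq σ⁻¹ fun x => ‖f x‖ ^ (2 : ENNReal).toReal }
  map_one' := by
    ext f x
    rfl
  map_mul' σ τ := by
    ext f x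
    change f ((σ * τ)⁻¹ x) = f (τ⁻¹ (σ⁻¹ x))
    rw [mul_inv_rev, Equiv.Perm.mul_apply]

theorem permUnitary_apply (σ : Equiv.Perm X) (f : lp (fun _ : X => ℂ) 2) (x : X) :
    permUnitary X σ f x = f (σ⁻¹ x) := rfl

variable {G : Type*} [Group G] {α : G →* Equiv.Perm X}

/-- If some element of `G` has only infinite orbits in `X`, then `ℓ²(X)` has no non-zero
finite-dimensional subrepresentation: the iterates of a vector tend to zero coordinatewise, but
accumulate at a vector of the same norm. -/
theorem eq_bot_of_finiteDimensional {t : G}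
    (ht : ∀ x : X, Function.Injective fun n : ℕ => (α (t ^ n))⁻¹ x)
    (W : Submodule ℂ (lp (fun _ : X => ℂ) 2)) [FiniteDimensional ℂ W]
    (hW : ∀ g : G, ∀ w ∈ W, (permUnitary X).comp α g w ∈ W) : W = ⊥ := by
  rw [eq_bot_iff]
  intro w hw
  have : ProperSpace W := FiniteDimensional.proper ℂ W
  let u : ℕ → W := fun n => ⟨(permUnitary X).comp α (t ^ n) w, hW _ w hw⟩
  have hu : ∀ n, u n ∈ Metric.sphere (0 : W) ‖w‖ := fun n => by
    rw [mem_sphere_zero_iff_norm]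
    exact ((permUnitary X).comp α (t ^ n)).norm_map w
  obtain ⟨y, hy, φ, hφ, hlim⟩ := (isCompact_sphere (0 : W) ‖w‖).tendsto_subseq hu
  have hcoord : ∀ x, (y : lp (fun _ : X => ℂ) 2) x = 0 := by
    intro x
    have h1 : Filter.Tendsto (fun n => ((u (φ n) : lp (fun _ : X => ℂ) 2) x)) Filter.atTop
        (nhds ((y : lp (fun _ : X => ℂ) 2) x)) := by
      rw [tendsto_iff_norm_sub_tendsto_zero] at hlim ⊢
      refine squeeze_zero (fun _ => norm_nonneg _) (fun n => ?_) hlim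
      exact lp.norm_apply_le_norm (by norm_num)
        ((u (φ n) - y : W) : lp (fun _ : X => ℂ) 2) x
    have h2 : Filter.Tendsto (fun n => ((u (φ n) : lp (fun _ : X => ℂ) 2) x)) Filter.atTop
        (nhds 0) := by
      have h3 := (lp.memℓp w).summable (by norm_num)
      have h4 : Filter.Tendsto (fun x => ‖w x‖ ^ 2) Filter.cofinite (nhds 0) := by
        simpa using h3.tendsto_cofinite_zero
      have h5 : Filter.Tendsto (fun x => ‖w x‖) Filter.cofinite (nhds 0) := by
        have h6 := h4.sqrt
        simpa [Real.sqrt_sq] using h6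
      have h6 : Filter.Tendsto (fun n : ℕ => (α (t ^ φ n))⁻¹ x) Filter.atTop Filter.cofinite := by
        rw [← Nat.cofinite_eq_atTop]
        exact ((ht x).comp hφ.injective).tendsto_cofinite
      exact tendsto_zero_iff_norm_tendsto_zero.2 (h5.comp h6)
    exact tendsto_nhds_unique h1 h2
  have hy0 : y = 0 := Subtype.ext (lp.ext (funext hcoord))
  rw [mem_sphere_zero_iff_norm, hy0, norm_zero] at hy
  exact (Submodule.mem_bot ℂ).2 (norm_eq_zero.1 hy.symm)

/-- The cocycle `g ↦ f - g f` of a function `f` on `X`, not necessarily square summable, whose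
translates differ from `f` at finitely many points only. -/
noncomputable def differenceCocycle (α : G →* Equiv.Perm X) (f : X → ℂ)
    (hf : ∀ g : G, {x | f (α g x) ≠ f x}.Finite) (g : G) : lp (fun _ : X => ℂ) 2 :=
  ⟨fun x => f x - f ((α g)⁻¹ x), memℓp_of_finite_support ((hf g⁻¹).subset fun x hx => by
    rw [Function.mem_support, sub_ne_zero] at hx
    rw [Set.mem_ofPred_eq, map_inv]
    exact hx.symm)⟩

theorem differenceCocycle_apply {f : X → ℂ} (hf : ∀ g : G, {x | f (α g x) ≠ f x}.Finite) (g : G)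
    (x : X) : differenceCocycle α f hf g x = f x - f ((α g)⁻¹ x) := rfl

theorem differenceCocycle_mem {f : X → ℂ} (hf : ∀ g : G, {x | f (α g x) ≠ f x}.Finite) :
    differenceCocycle α f hf ∈ oneCocycles ((permUnitary X).comp α) := by
  intro g h
  refine lp.ext (funext fun x => ?_)
  change f x - f ((α (g * h))⁻¹ x) =
    (f x - f ((α g)⁻¹ x)) + (f ((α g)⁻¹ x) - f ((α h)⁻¹ ((α g)⁻¹ x)))
  rw [map_mul, mul_inv_rev, Equiv.Perm.mul_apply]
  ring

end PermutationRepresentation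

namespace UnitaryRep

/-- A criterion for a cocycle not to be a limit of coboundaries: its pairing with a `1`-cycle,
supported on the elements `t` and `r c`, is not zero. -/
theorem notMem_closure_of_cycle {G : Type*} [Group G] {H : Type*} [NormedAddCommGroup H]
    [InnerProductSpace ℂ H] {π : G →* (H ≃ₗᵢ[ℂ] H)} {ι : Type*} [Fintype ι] {t : G} {r : ι → G}
    {ξ ζ : H} (hζ : ζ = π t⁻¹ ξ - ξ) (hsum : ∑ c, π (r c)⁻¹ ζ = 0) {b : G → H}
    (hb : (Fintype.card ι : ℂ) * inner ℂ ξ (b t) + inner ℂ ζ (∑ c, b (r c)) ≠ 0) :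
    b ∉ (oneCoboundaries π).topologicalClosure := by
  intro hmem
  let Φ : (G → H) → ℂ := fun β =>
    (Fintype.card ι : ℂ) * inner ℂ ξ (β t) + inner ℂ ζ (∑ c, β (r c))
  have hΦ : Continuous Φ := by fun_prop
  have hadj : ∀ (g : G) (x y : H), inner ℂ x (π g y) = inner ℂ (π g⁻¹ x) y := fun g x y => by
    rw [← (π g⁻¹).inner_map_map x (π g y), map_inv_map_apply]
  have hzero : Set.MapsTo Φ (oneCoboundaries π : Set (G → H)) {0} := by
    rintro β ⟨v, hv⟩
    have h1 : (inner ℂ ξ (β t) : ℂ) = -inner ℂ ζ v := by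
      rw [hv, inner_sub_right, hadj, hζ, inner_sub_left]
      ring
    have h2 : (inner ℂ ζ (∑ c, β (r c)) : ℂ) = Fintype.card ι * inner ℂ ζ v := by
      have h3 : ∀ c, (inner ℂ ζ (β (r c)) : ℂ) = inner ℂ ζ v - inner ℂ (π (r c)⁻¹ ζ) v := fun c => by
        rw [hv, inner_sub_right, hadj]
      have h4 : ∑ c, (inner ℂ (π (r c)⁻¹ ζ) v : ℂ) = 0 := by
        rw [← sum_inner, hsum, inner_zero_left]
      rw [inner_sum, Finset.sum_congr rfl fun c _ => h3 c, Finset.sum_sub_distrib,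
          h4, sub_zero, Finset.sum_const, Finset.card_univ, nsmul_eq_mul]
    rw [Set.mem_singleton_iff]
    change (Fintype.card ι : ℂ) * inner ℂ ξ (β t) + inner ℂ ζ (∑ c, β (r c)) = 0
    rw [h1, h2]
    ring
  have h := map_mem_closure hΦ hmem hzero
  rw [closure_singleton] at h
  exact hb h

end UnitaryRep

namespace DiscreteAffine

/-! ### A cocycle of the discrete affine group -/

section TreeCocycle

variable {q : ℕ}

open Classical in
/-- The function on the tree that is `1` on a vertex if it is the distinguished child, of label
`0`, of its parent, and `0` otherwise. -/
noncomputable def isZeroChild (v : Vertex q) : ℂ := if v.label v.level = 0 then 1 else 0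

open Classical in
/-- A square summable function supported below `o`. Up to the factor `q ^ (level + 1)` its value at
`v` depends on the last label of `v` only, and it has zero sum over the children of a vertex. -/
noncomputable def balanced (v : Vertex q) : ℂ :=
  if Below v then (q : ℂ) ^ (v.level + 1) * (q * isZeroChild v - 1) else 0

theorem isZeroChild_shift (v : Vertex q) : isZeroChild (shift q v) = isZeroChild v := by
  change isZeroChild (translate 1 v) = _
  rw [isZeroChild, isZeroChild, translate_label, level_translate, add_sub_cancel_right]

theorem rotateFun_of_not_below {v : Vertex q} (h : ¬ Below v) (c : ZMod q) :
    rotateFun c v = v := by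
  classical
  refine Vertex.ext' rfl fun i => ?_
  rw [rotateFun_label, if_neg (fun h' => h h'.1), add_zero]

/-- The rotation at `o` changes the last label only at the children of `o`. -/
theorem isZeroChild_rotateFun_of_ne {v : Vertex q} (h : v.level ≠ -1) (c : ZMod q) :
    isZeroChild (rotateFun c v) = isZeroChild v := by
  classical
  have h1 : (rotateFun c v).level = v.level := rfl
  have h2 : (rotateFun c v).label v.level = v.label v.level := by
    rw [rotateFun_label, if_neg (fun h' => h h'.2), add_zero]
  rw [isZeroChild, isZeroChild, h1, h2]

theorem isZeroChild_rotateFun_of_eq {v : Vertex q} (hv : Below v) (h : v.level = -1) (c : ZMod q) :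
    isZeroChild (rotateFun c v) = if v.label (-1) + c = 0 then 1 else 0 := by
  classical
  have h1 : (rotateFun c v).level = v.level := rfl
  have h2 : (rotateFun c v).label (-1) = v.label (-1) + c := by
    rw [rotateFun_label, if_pos ⟨hv, rfl⟩]
  rw [isZeroChild, h1, h, h2]

theorem sum_ite_add_eq_zero [NeZero q] (k : ZMod q) (x : ℂ) :
    ∑ c : ZMod q, (if k + c = 0 then x else 0) = x := by
  rw [Finset.sum_eq_single (-k)]
  · simp
  · intro c _ hc
    rw [if_neg fun h => hc (neg_eq_of_add_eq_zero_right h).symm]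
  · simp

theorem below_of_below_shift {v : Vertex q} (h : Below (translate 1 v)) : Below v := by
  refine ⟨?_, fun i hi => ?_⟩
  · have := h.1
    rw [level_translate] at this
    omega
  · have := h.2 (i + 1) (by omega)
    rwa [translate_label, add_sub_cancel_right] at this

theorem below_shift_rotateFun_iff {v : Vertex q} (hv : Below v) (hl : v.level ≠ -1) (c : ZMod q) :
    Below (translate 1 (rotateFun c v)) ↔ v.label (-1) + c = 0 := by
  classical
  constructor
  · intro h
    have h1 := h.2 0 le_rfl
    rwa [translate_label, rotateFun_label, if_pos ⟨hv, by norm_num⟩] at h1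
  · intro h
    refine ⟨?_, fun i hi => ?_⟩
    · have h1 : v.level < 0 := hv.1
      change v.level + 1 < 0
      omega
    · rw [translate_label, rotateFun_label]
      rcases eq_or_ne i 0 with rfl | hi0
      · rw [if_pos ⟨hv, by norm_num⟩]
        exact h
      · rw [if_neg (fun h' => by omega), add_zero, hv.2 _ (by omega)]

/-- The difference of `balanced` and its translate has zero sum over the rotations at `o`. -/
theorem sum_balanced_shift_sub [NeZero q] (v : Vertex q) :
    ∑ c : ZMod q, (balanced (translate 1 (rotateFun c v)) - balanced (rotateFun c v)) = 0 := by
  classical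
  have hq : (q : ℂ) ≠ 0 := Nat.cast_ne_zero.2 (NeZero.ne q)
  by_cases hv : Below v
  swap
  · refine Finset.sum_eq_zero fun c _ => ?_
    rw [rotateFun_of_not_below hv, balanced, balanced, if_neg hv,
      if_neg fun h => hv (below_of_below_shift h), sub_zero]
  have h1 : ∀ c, balanced (rotateFun c v) =
      (q : ℂ) ^ (v.level + 1) * (q * isZeroChild (rotateFun c v) - 1) := fun c => by
    rw [balanced, if_pos ((below_rotateFun c v).2 hv)]
    rfl
  rcases eq_or_ne v.level (-1) with hl | hl
  · have h2 : ∀ c, balanced (translate 1 (rotateFun c v)) = 0 := fun c => by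
      rw [balanced, if_neg]
      intro h
      have h3 : v.level + 1 < 0 := h.1
      omega
    simp only [h1, h2, hl, isZeroChild_rotateFun_of_eq hv hl, zero_sub, Finset.sum_neg_distrib,
      ← Finset.mul_sum, Finset.sum_sub_distrib, sum_ite_add_eq_zero]
    simp [ZMod.card]
  · have h2 : ∀ c, balanced (translate 1 (rotateFun c v)) = if v.label (-1) + c = 0 then
        (q : ℂ) ^ (v.level + 1 + 1) * (q * isZeroChild v - 1) else 0 := fun c => by
      rw [balanced]
      refine if_congr (below_shift_rotateFun_iff hv hl c) ?_ rfl
      rw [← isZeroChild_rotateFun_of_ne hl c, ← isZeroChild_shift (rotateFun c v)]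
      rfl
    simp only [h1, h2, isZeroChild_rotateFun_of_ne hl, Finset.sum_sub_distrib,
      sum_ite_add_eq_zero, Finset.sum_const, Finset.card_univ, ZMod.card, nsmul_eq_mul]
    rw [zpow_add_one₀ hq]
    ring

/-- The sum over the rotations `r` at `o` of the differences `f - r f`, where `f` is `isZeroChild`,
is supported on the children of `o`, where it is opposite to the difference of `balanced` and its
translate. -/
theorem sum_isZeroChild_sub [NeZero q] (v : Vertex q) :
    ∑ c : ZMod q, (isZeroChild v - isZeroChild (rotateFun (-c) v)) = 0 ∨
      ∑ c : ZMod q, (isZeroChild v - isZeroChild (rotateFun (-c) v)) =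
        -(balanced (translate 1 v) - balanced v) := by
  classical
  by_cases hv : Below v
  swap
  · exact Or.inl (Finset.sum_eq_zero fun c _ => by rw [rotateFun_of_not_below hv, sub_self])
  rcases eq_or_ne v.level (-1) with hl | hl
  swap
  · exact Or.inl (Finset.sum_eq_zero fun c _ => by rw [isZeroChild_rotateFun_of_ne hl, sub_self])
  right
  have h2 : balanced (translate 1 v) = 0 := by
    rw [balanced, if_neg]
    intro h
    have h3 : v.level + 1 < 0 := h.1
    omega
  have h3 : ∑ c : ZMod q, isZeroChild (rotateFun (-c) v) = 1 := by
    have h := Equiv.sum_comp (Equiv.neg (ZMod q)) fun c => isZeroChild (rotateFun c v)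
    simp only [Equiv.neg_apply] at h
    rw [h]
    simp only [isZeroChild_rotateFun_of_eq hv hl, sum_ite_add_eq_zero]
  rw [Finset.sum_sub_distrib, h3, h2, balanced, if_pos hv, hl]
  simp [ZMod.card]

/-- The `q` children of `o`. -/
noncomputable def child (k : ZMod q) : Vertex q where
  level := -1
  label := Finsupp.single (-1) k
  label_eq_zero i hi := by rw [Finsupp.single_apply, if_neg (by omega)]

theorem below_child (k : ZMod q) : Below (child k) :=
  ⟨neg_one_lt_zero, fun i hi => by
    change Finsupp.single (-1) k i = 0
    rw [Finsupp.single_apply, if_neg (by omega)]⟩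

theorem exists_child_eq {v : Vertex q} (hv : Below v) (hl : v.level = -1) : ∃ k, child k = v := by
  refine ⟨v.label (-1), Vertex.ext' hl.symm fun i => ?_⟩
  change Finsupp.single (-1) (v.label (-1)) i = v.label i
  rw [Finsupp.single_apply]
  split_ifs with h
  · rw [h]
  · rcases lt_or_ge i (-1) with hi | hi
    · exact (v.label_eq_zero i (by omega)).symm
    · exact (hv.2 i (by omega)).symm

theorem sum_isZeroChild_sub_child_ne_zero [Fact q.Prime] :
    ∑ c : ZMod q, (isZeroChild (child (0 : ZMod q)) - isZeroChild (rotateFun (-c) (child 0))) ≠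
      0 := by
  classical
  have hq : 1 < q := (Fact.out : q.Prime).one_lt
  have h1 : isZeroChild (child (0 : ZMod q)) = 1 := by
    rw [isZeroChild, if_pos]
    change Finsupp.single (-1) (0 : ZMod q) (-1) = 0
    simp
  have h3 : ∑ c : ZMod q, isZeroChild (rotateFun (-c) (child (0 : ZMod q))) = 1 := by
    have h := Equiv.sum_comp (Equiv.neg (ZMod q)) fun c => isZeroChild (rotateFun c (child 0))
    simp only [Equiv.neg_apply] at h
    rw [h]
    simp only [isZeroChild_rotateFun_of_eq (below_child 0) rfl, sum_ite_add_eq_zero]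
  rw [Finset.sum_sub_distrib, h3, h1]
  simp only [Finset.sum_const, Finset.card_univ, ZMod.card, nsmul_eq_mul, mul_one]
  rw [sub_ne_zero]
  exact_mod_cast hq.ne'

/-- The elements of the discrete affine group change `isZeroChild` at finitely many vertices. -/
theorem finite_isZeroChild_ne [NeZero q] {g : tree q ≃g tree q} (hg : g ∈ DA q) :
    {v | isZeroChild (g v) ≠ isZeroChild v}.Finite := by
  rw [DA] at hg
  induction hg using Subgroup.closure_induction with
  | mem g hg =>
    rcases hg with rfl | ⟨c, rfl⟩
    · simp [isZeroChild_shift]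
    · refine (Set.finite_range (child (q := q))).subset fun v hv => ?_
      rw [Set.mem_ofPred_eq, rotate_apply] at hv
      by_cases hb : Below v
      · by_cases hl : v.level = -1
        · exact exists_child_eq hb hl
        · exact absurd (isZeroChild_rotateFun_of_ne hl c) hv
      · exact absurd (by rw [rotateFun_of_not_below hb]) hv
  | one => simp
  | mul g h _ _ hg hh =>
    refine ((hg.preimage h.injective.injOn).union hh).subset fun v hv => ?_
    by_contra hv'
    simp only [Set.mem_union, Set.mem_preimage, Set.mem_ofPred_eq, not_or, not_not] at hv'
    exact hv (hv'.1.trans hv'.2)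
  | inv g _ hg =>
    refine (hg.preimage (g⁻¹).injective.injOn).subset fun v hv => ?_
    rw [Set.mem_preimage, Set.mem_ofPred_eq, ← RelIso.mul_apply, mul_inv_cancel]
    exact fun h => hv h.symm

/-! ### Square summability -/

/-- The vertices below `o` at level `-(k + 1)`, in terms of their labels. -/
noncomputable def ofLabels (p : Σ k : ℕ, Fin (k + 1) → ZMod q) : Vertex q where
  level := -(p.1 + 1)
  label := Finsupp.onFinset (Finset.Ico (-(p.1 + 1 : ℤ)) 0)
    (fun j => if h : -(p.1 + 1 : ℤ) ≤ j ∧ j < 0 then p.2 ⟨(j + p.1 + 1).toNat, by omega⟩ else 0)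
    (fun j hj => by
      by_contra h
      rw [Finset.mem_Ico] at h
      exact hj (dif_neg h))
  label_eq_zero i hi := by
    rw [Finsupp.onFinset_apply, dif_neg (by omega)]

/-- The labels of a vertex below `o`. -/
def labels (v : Vertex q) : Σ k : ℕ, Fin (k + 1) → ZMod q :=
  ⟨(-1 - v.level).toNat, fun i => v.label (v.level + i)⟩

theorem ofLabels_labels {v : Vertex q} (hv : Below v) : ofLabels (labels v) = v := by
  have h1 : v.level < 0 := hv.1
  have h2 : (((-1 - v.level).toNat : ℕ) : ℤ) = -1 - v.level := Int.toNat_of_nonneg (by omega)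
  refine Vertex.ext' ?_ fun j => ?_
  · change -((((-1 - v.level).toNat : ℕ) : ℤ) + 1) = v.level
    omega
  · have h3 : ((labels v).1 : ℤ) = -1 - v.level := h2
    by_cases h : -((labels v).1 + 1 : ℤ) ≤ j ∧ j < 0
    · refine (dif_pos h).trans (congrArg v.label ?_)
      change v.level + ((j + (labels v).1 + 1).toNat : ℤ) = j
      rw [Int.toNat_of_nonneg (by omega)]
      omega
    · refine (dif_neg h).trans ?_
      rcases lt_or_ge j v.level with hj | hj
      · exact (v.label_eq_zero j hj).symm
      · exact (hv.2 j (by omega)).symm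

theorem summable_labels [Fact q.Prime] :
    Summable fun p : Σ k : ℕ, Fin (k + 1) → ZMod q => ((q : ℝ)⁻¹ ^ p.1) ^ 2 := by
  have hq : (1 : ℝ) < q := by exact_mod_cast (Fact.out : q.Prime).one_lt
  have hq0 : (q : ℝ) ≠ 0 := by positivity
  rw [summable_sigma_of_nonneg fun p => by positivity]
  refine ⟨fun k => (hasSum_fintype _).summable, ?_⟩
  have h : ∀ k : ℕ, ∑' _ : Fin (k + 1) → ZMod q, ((q : ℝ)⁻¹ ^ k) ^ 2 = q * (q : ℝ)⁻¹ ^ k := by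
    intro k
    rw [tsum_fintype, Finset.sum_const, Finset.card_univ, Fintype.card_fun, ZMod.card,
      Fintype.card_fin, nsmul_eq_mul]
    push_cast
    have h1 : (q : ℝ) ^ k * (q : ℝ)⁻¹ ^ k = 1 := by
      rw [← mul_pow, mul_inv_cancel₀ hq0, one_pow]
    generalize (q : ℝ)⁻¹ ^ k = x at *
    linear_combination q * x * h1
  simp only [h]
  exact (summable_geometric_of_lt_one (by positivity) (inv_lt_one_of_one_lt₀ hq)).mul_left _

theorem norm_balanced_le [Fact q.Prime] {v : Vertex q} (hb : Below v) :
    ‖balanced v‖ ≤ q * (q : ℝ)⁻¹ ^ (labels v).1 := by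
  have hq : (1 : ℝ) < q := by exact_mod_cast (Fact.out : q.Prime).one_lt
  have hv : v.level < 0 := hb.1
  have h3 : ((labels v).1 : ℤ) = -1 - v.level := Int.toNat_of_nonneg (by omega)
  have h4 : ‖(q : ℂ) ^ (v.level + 1)‖ = (q : ℝ)⁻¹ ^ (labels v).1 := by
    rw [norm_zpow, Complex.norm_natCast, inv_pow, ← zpow_natCast, ← zpow_neg, h3]
    congr 1
    ring
  have h5 : ‖(q : ℂ) * isZeroChild v - 1‖ ≤ q := by
    rw [isZeroChild]
    split_ifs
    · rw [mul_one, show (q : ℂ) - 1 = ((q - 1 : ℝ) : ℂ) by push_cast; ring, Complex.norm_real,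
        Real.norm_of_nonneg (by linarith)]
      linarith
    · simpa using hq.le
  rw [balanced, if_pos hb, norm_mul, h4, mul_comm]
  exact mul_le_mul_of_nonneg_right h5 (by positivity)

theorem summable_norm_balanced_sq [Fact q.Prime] :
    Summable fun v : Vertex q => ‖balanced v‖ ^ 2 := by
  classical
  have hinj : Function.Injective fun v : {v : Vertex q | Below v} => labels v.1 := by
    intro u v huv
    have h := congrArg ofLabels huv
    simp only [ofLabels_labels u.2, ofLabels_labels v.2] at h
    exact Subtype.ext h
  have h1 := ((summable_labels (q := q)).comp_injective hinj).mul_left ((q : ℝ) ^ 2)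
  have h2 : Summable fun v : {v : Vertex q | Below v} => ‖balanced v.1‖ ^ 2 := by
    refine Summable.of_nonneg_of_le (fun _ => sq_nonneg _) (fun v => ?_) h1
    have h3 := pow_le_pow_left₀ (norm_nonneg _) (norm_balanced_le v.2) 2
    rwa [mul_pow] at h3
  have h3 := summable_subtype_iff_indicator (f := fun v => ‖balanced v‖ ^ 2).1 h2
  refine h3.congr fun v => ?_
  by_cases hv : Below v
  · rw [Set.indicator_of_mem (s := {v : Vertex q | Below v}) hv]
  · rw [Set.indicator_of_notMem (s := {v : Vertex q | Below v}) hv, balanced, if_neg hv]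
    simp

end TreeCocycle

end DiscreteAffine

namespace DiscreteAffine

/-! ### Failure of property `H_FD` -/

section NotHFD

open UnitaryRep Gromov

variable {q : ℕ}

/-- The action of the automorphism group on the vertices of the tree, lifted to a universe. -/
def vertexPerm.{w} (q : ℕ) : (tree q ≃g tree q) →* Equiv.Perm (ULift.{w} (Vertex q)) where
  toFun g := (Equiv.ulift.trans g.toEquiv).trans Equiv.ulift.symm
  map_one' := rfl
  map_mul' _ _ := rfl

theorem vertexPerm_apply.{w} (g : tree q ≃g tree q) (x : ULift.{w} (Vertex q)) :
    vertexPerm q g x = ULift.up (g x.down) := rfl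

/-- A group that acts on the tree through the discrete affine group, and whose image contains the
shift and the rotations at `o`, does not have property `H_FD`: its representation on the square
summable functions on the vertices is a counterexample. -/
theorem not_hasPropertyHFD.{u, w} [Fact q.Prime] {G : Type u} [Group G]
    (ρ : G →* (tree q ≃g tree q)) (hρ : ∀ g, ρ g ∈ DA q) {t : G} (ht : ρ t = shift q)
    {r : ZMod q → G} (hr : ∀ c, ρ (r c) = rotate q c) : ¬ HasPropertyHFD.{u, w} G := by
  intro hG
  set α : G →* Equiv.Perm (ULift.{w} (Vertex q)) := (vertexPerm q).comp ρ with hα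
  set f : ULift.{w} (Vertex q) → ℂ := fun x => isZeroChild x.down with hfdef
  have hf : ∀ g : G, {x | f (α g x) ≠ f x}.Finite := fun g =>
    (finite_isZeroChild_ne (hρ g)).preimage (f := ULift.down) ULift.down_injective.injOn
  have hξ : Memℓp (fun x : ULift.{w} (Vertex q) => balanced x.down) 2 := by
    rw [memℓp_gen_iff (by norm_num)]
    have h := (summable_norm_balanced_sq (q := q)).comp_injective
      (ULift.down_injective : Function.Injective (ULift.down : ULift.{w} (Vertex q) → Vertex q))
    simpa [Function.comp_def] using h
  set π := (permUnitary (ULift.{w} (Vertex q))).comp α with hπ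
  set ξ : lp (fun _ : ULift.{w} (Vertex q) => ℂ) 2 := ⟨_, hξ⟩ with hξdef
  set ζ : lp (fun _ : ULift.{w} (Vertex q) => ℂ) 2 := π t⁻¹ ξ - ξ with hζ
  -- the inverse of a rotation is the opposite rotation
  have hrinv : ∀ c x, ((α (r c))⁻¹ x).down = rotateFun (-c) x.down := fun c x => by
    rw [← map_inv, hα, MonoidHom.comp_apply, vertexPerm_apply, map_inv, hr]
    rfl
  have hζapply : ∀ x, ζ x = balanced (translate 1 x.down) - balanced x.down := by
    intro x
    have h1 : π t⁻¹ ξ x = balanced (translate 1 x.down) := by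
      rw [hπ, MonoidHom.comp_apply, permUnitary_apply, ← map_inv, inv_inv]
      change balanced (ρ t x.down) = _
      rw [ht]
      rfl
    rw [hζ]
    change π t⁻¹ ξ x - ξ x = _
    rw [h1]
  have hsum : ∑ c, π (r c)⁻¹ ζ = 0 := by
    refine lp.ext (funext fun x => ?_)
    rw [lp.coeFn_sum, Finset.sum_apply]
    refine Eq.trans (Finset.sum_congr rfl fun c _ => ?_) (sum_balanced_shift_sub x.down)
    rw [hπ, MonoidHom.comp_apply, permUnitary_apply, ← map_inv, inv_inv, hζapply]
    have h1 : (α (r c) x).down = rotateFun c x.down := by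
      change ρ (r c) x.down = _
      rw [hr]
      rfl
    rw [h1]
  set b := differenceCocycle α f hf with hb
  have hbt : b t = 0 := by
    refine lp.ext (funext fun x => ?_)
    rw [hb, differenceCocycle_apply]
    have h1 : isZeroChild ((α t)⁻¹ x).down = isZeroChild x.down := by
      rw [← isZeroChild_shift, ← ht]
      change isZeroChild (α t ((α t).symm x)).down = _
      rw [Equiv.apply_symm_apply]
    exact sub_eq_zero.2 h1.symm
  have hBapply : ∀ x, (∑ c, b (r c)) x =
      ∑ c : ZMod q, (isZeroChild x.down - isZeroChild (rotateFun (-c) x.down)) := by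
    intro x
    rw [lp.coeFn_sum, Finset.sum_apply]
    refine Finset.sum_congr rfl fun c _ => ?_
    rw [hb, differenceCocycle_apply, hfdef]
    beta_reduce
    rw [hrinv]
  -- the pairing of the cycle with the cocycle is `-‖∑ c, b (r c)‖ ^ 2`
  have hpair : (inner ℂ ζ (∑ c, b (r c)) : ℂ) =
      -inner ℂ (∑ c, b (r c)) (∑ c, b (r c)) := by
    rw [← inner_neg_left, ← sub_eq_zero, ← inner_sub_left, lp.inner_eq_tsum]
    refine (tsum_congr fun x => ?_).trans tsum_zero
    have h1 : (ζ - -∑ c, b (r c)) x = ζ x + (∑ c, b (r c)) x := by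
      rw [sub_neg_eq_add]
      rfl
    rw [h1]
    rcases sum_isZeroChild_sub x.down with h | h
    · rw [hBapply, h, inner_zero_right]
    · rw [hBapply, h, hζapply, add_neg_cancel, inner_zero_left]
  have hne : ∑ c, b (r c) ≠ 0 := by
    intro h
    have h1 := hBapply (ULift.up (child 0))
    rw [h] at h1
    exact sum_isZeroChild_sub_child_ne_zero h1.symm
  have hnot : b ∉ (oneCoboundaries π).topologicalClosure := by
    refine notMem_closure_of_cycle hζ hsum ?_
    rw [hbt, inner_zero_right, mul_zero, zero_add, hpair]
    exact neg_ne_zero.2 (inner_self_ne_zero.2 hne)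
  obtain ⟨W, hWne, hWfin, hW⟩ := hG _ π
    (nontrivial_of_notMem_closure (differenceCocycle_mem hf) hnot)
  refine hWne (eq_bot_of_finiteDimensional (t := t) (fun x m n hmn => ?_) W hW)
  -- the shift moves the levels
  have hlevel : ∀ n : ℕ, ((α (t ^ n))⁻¹ x).down.level = x.down.level - n := by
    intro n
    have h1 : ((α (t ^ n))⁻¹ x).down = translate (-n) x.down := by
      rw [← map_inv, hα, MonoidHom.comp_apply, vertexPerm_apply, map_inv, map_pow, ht,
        ← shift_zpow_apply, zpow_neg, zpow_natCast]
    rw [h1, level_translate]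
    ring
  have h2 := congrArg (fun y : ULift.{w} (Vertex q) => y.down.level) hmn
  simp only [hlevel] at h2
  omega

end NotHFD

end DiscreteAffine

theorem proposition4p8 (q : ℕ) (hq : q.Prime) (κ : ℕ → ℕ) (hκ : Monotone κ) (hκ0 : κ 0 = 2) :
    (BddAbove (Set.range κ) → HasPropertyHT.{0, v} (Gromov.GromovGroup q κ)) ∧
    ((∀ n : ℕ, 1 ≤ n → q ^ (n + 1) < κ n) →
      (∃ φ : Gromov.GromovGroup q κ →* DiscreteAffine.DA q, Function.Surjective φ) ∧
      ¬ HasPropertyHFD.{0, v} (Gromov.GromovGroup q κ)) := by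
  have : Fact q.Prime := ⟨hq⟩
  refine ⟨fun h => Gromov.hasPropertyHT_of_bddAbove hκ (by omega) h, fun h => ?_⟩
  have hle := DiscreteAffine.normalClosure_relators_le hκ0 h
  exact ⟨DiscreteAffine.exists_surjective_DA hle,
    DiscreteAffine.not_hasPropertyHFD (DiscreteAffine.toAut hle) (DiscreteAffine.toAut_mem_DA hle)
      (DiscreteAffine.toAut_inr_one hle) (DiscreteAffine.toAut_inl_of hle)⟩
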